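/- Let $\mathcal A$ be a finite set, $\mathcal P$ the set of probability distributions on $\mathcal A$, and $H[p]=-\sum_{\alpha}p_\alpha\log p_\alpha$. For a real matrix $\mathbf R$ with columns indexed by $\mathcal A$ and $f\in\mathcal P$, let $[f]_{\mathbf R}=\{p\in\mathcal P:\mathbf R p=\mathbf R f\}$; the MaxEnt distribution of this class is its unique member of maximal entropy. Let $\widehat{\mathbf R}\in\mathbb R^{\widehat D\times\mathcal A}$ and $\widehat{\mathbf R}'\in\mathbb R^{\widehat D'\times\mathcal A}$ be architecture matrices of full row rank $\widehat D$ and $\widehat D'$, such that $\widehat{\mathbf R}'$ implies $\widehat{\mathbf R}$, i.e. $\widehat{\mathbf R}=\mathbf T\widehat{\mathbf R}'$ for some real matrix $\mathbf T$. Assume that the row space of $\widehat{\mathbf R}$ is the row space of a matrix with integer entries (for instance of a binary matrix of marginal constraints) and contains the all-ones vector (normalization). Let $f$ be an empirical distribution (the relative frequencies of some finite dataset) such that no microstate is forced to have probability zero: for every $\alpha\in\mathcal A$ there is $p\in[f]_{\widehat{\mathbf R}}$ with $p_\alpha>0$. For a sample size $N$, let $g$ be a random element of the set of those members of $[f]_{\widehat{\mathbf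 R}}$ that are relative frequencies of a dataset with $N$ records, drawn with probability $$\frac{\exp\{N H[g]\}}{\sum_{g'}\exp\{N H[g']\}},$$ the sum running over the same set. Let $\hat p$ be the MaxEnt distribution of $[g]_{\widehat{\mathbf R}}=[f]_{\widehat{\mathbf R}}$ and $\hat p'$ the MaxEnt distribution of $[g]_{\widehat{\mathbf R}'}\subseteq[f]_{\widehat{\mathbf R}}$. Then, as $N\to\infty$ through the sample sizes for which this set is non-empty, $2N(H[\hat p]-H[\hat p'])$ converges in distribution to the $\chi^2$-distribution with $\widehat D'-\widehat D$ degrees of freedom; more precisely, for every $x\in\mathbb R$ the probability that $2N(H[\hat p]-H[\hat p'])\le x$ tends to $\chi^2_{\widehat D'-\widehat D}((-\infty,x])$, where $\chi^2_0$ is the unit mass at $0$. -/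

import Mathlib

open Filter Topology MeasureTheory ProbabilityTheory

namespace MaxEntModel

variable {A : Type*} [Fintype A]

/-- Shannon entropy `H[p] = - ∑ α, p α * log (p α)` (with `0 * log 0 = 0`). -/
noncomputable def entropy (p : A → ℝ) : ℝ := ∑ α, Real.negMulLog (p α)

/-- The equivalence class `[f]_R`: all distributions on `A` that have the same
moments `R p = R f` as `f`. -/
def eqClass {ι : Type*} (R : Matrix ι A ℝ) (f : A → ℝ) : Set (A → ℝ) :=
  {p | p ∈ stdSimplex ℝ A ∧ R.mulVec p = R.mulVec f}

/-- `p` is a distribution of maximum entropy in the class `S`. -/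
def IsMaxEnt (S : Set (A → ℝ)) (p : A → ℝ) : Prop :=
  p ∈ S ∧ ∀ q ∈ S, entropy q ≤ entropy p

/-- The MaxEnt distribution of the class `S`. For `S = [f]_R` with `f` a distribution it
exists and is unique, see `isMaxEnt_maxEnt` and `IsMaxEnt.unique`. -/
noncomputable def maxEnt (S : Set (A → ℝ)) : A → ℝ := Classical.epsilon (IsMaxEnt S)

theorem exists_isMaxEnt {ι : Type*} (R : Matrix ι A ℝ) {f : A → ℝ}
    (hf : f ∈ stdSimplex ℝ A) : ∃ p, IsMaxEnt (eqClass R f) p := by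
  have hc : IsCompact (eqClass R f) := by
    refine (isCompact_stdSimplex ℝ A).inter_right
      (isClosed_eq (f := fun p : A → ℝ => R.mulVec p) ?_ continuous_const)
    exact Continuous.matrix_mulVec continuous_const continuous_id
  have hcont : Continuous (entropy (A := A)) := by
    unfold entropy
    exact continuous_finsetSum _ fun α _ =>
      Real.continuous_negMulLog.comp (continuous_apply α)
  obtain ⟨p, hp, hmax⟩ := hc.exists_isMaxOn ⟨f, hf, rfl⟩ hcont.continuousOn
  exact ⟨p, hp, fun q hq => hmax hq⟩

theorem isMaxEnt_maxEnt {ι : Type*} (R : Matrix ι A ℝ) {f : A → ℝ}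
    (hf : f ∈ stdSimplex ℝ A) : IsMaxEnt (eqClass R f) (maxEnt (eqClass R f)) :=
  Classical.epsilon_spec (exists_isMaxEnt R hf)

theorem IsMaxEnt.unique {ι : Type*} {R : Matrix ι A ℝ} {f p q : A → ℝ}
    (hp : IsMaxEnt (eqClass R f) p) (hq : IsMaxEnt (eqClass R f) q) : p = q := by
  by_contra hne
  obtain ⟨α, hα⟩ := Function.ne_iff.mp hne
  have hmem : (1 / 2 : ℝ) • p + (1 / 2 : ℝ) • q ∈ eqClass R f := by
    refine ⟨convex_stdSimplex ℝ A hp.1.1 hq.1.1 (by norm_num) (by norm_num) (by norm_num), ?_⟩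
    rw [Matrix.mulVec_add, Matrix.mulVec_smul, Matrix.mulVec_smul, hp.1.2, hq.1.2, ← add_smul]
    norm_num
  have h1 := hp.2 _ hmem
  have h2 := hq.2 _ hp.1
  have hlt : (1 / 2 : ℝ) * entropy p + (1 / 2 : ℝ) * entropy q
      < entropy ((1 / 2 : ℝ) • p + (1 / 2 : ℝ) • q) := by
    unfold entropy
    rw [Finset.mul_sum, Finset.mul_sum, ← Finset.sum_add_distrib]
    refine Finset.sum_lt_sum (fun β _ => ?_) ⟨α, Finset.mem_univ _, ?_⟩
    · exact Real.concaveOn_negMulLog.2 (Set.mem_Ici.2 (hp.1.1.1 β)) (Set.mem_Ici.2 (hq.1.1.1 β))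
        (by norm_num) (by norm_num) (by norm_num)
    · exact Real.strictConcaveOn_negMulLog.2 (Set.mem_Ici.2 (hp.1.1.1 α))
        (Set.mem_Ici.2 (hq.1.1.1 α)) hα (by norm_num) (by norm_num) (by norm_num)
  have h3 := hp.2 _ hq.1
  linarith

/-- `R` is an architecture matrix of the linear constraint system with coefficient matrix `C`:
it has full row rank, it has the same row space as `C` (so that both systems are equivalent,
`R` having no redundant rows), and normalization is among the constraints. -/
structure IsArchitecture {κ : Type*} {D : ℕ} (C : Matrix κ A ℤ) (R : Matrix (Fin D) A ℝ) :
    Prop where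
  rank_eq : R.rank = D
  rowSpace_eq : Submodule.span ℝ (Set.range R.row) =
    Submodule.span ℝ (Set.range (C.map (Int.cast : ℤ → ℝ)).row)
  normalization : (fun _ => 1 : A → ℝ) ∈ Submodule.span ℝ (Set.range R.row)

/-- The architecture `R'` implies the architecture `R`: the constraints in `R` are linear
combinations of those in `R'`. -/
def Implies {D' D : ℕ} (R' : Matrix (Fin D') A ℝ) (R : Matrix (Fin D) A ℝ) : Prop :=
  ∃ T : Matrix (Fin D) (Fin D') ℝ, R = T * R'

/-- The relative frequencies of a dataset of `N` records with counts `n`. -/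
noncomputable def relFreq (N : ℕ) (n : A → ℕ) : A → ℝ := fun α => (n α : ℝ) / N

/-- `f` is an empirical distribution, i.e. the relative frequencies of some dataset. -/
def IsEmpirical (f : A → ℝ) : Prop :=
  ∃ (N : ℕ) (n : A → ℕ), 0 < N ∧ ∑ α, n α = N ∧ f = relFreq N n

open Classical in
/-- The (counts of) datasets of `N` records whose relative frequencies lie in `[f]_R`. -/
noncomputable def datasets {ι : Type*} (R : Matrix ι A ℝ) (f : A → ℝ) (N : ℕ) :
    Finset (A → ℕ) :=
  (Finset.piAntidiag Finset.univ N).filter fun n => relFreq N n ∈ eqClass R f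

/-- The distribution over distributions in `[f]_R` at sample size `N`: a member with
frequencies `g` has probability `exp (N H[g]) / ∑ g', exp (N H[g'])`. -/
noncomputable def classProb {ι : Type*} (R : Matrix ι A ℝ) (f : A → ℝ) (N : ℕ)
    (n : A → ℕ) : ℝ :=
  Real.exp (N * entropy (relFreq N n)) /
    ∑ k ∈ datasets R f N, Real.exp (N * entropy (relFreq N k))

/-- The scaled entropy difference `2 N (H[p] - H[p'])` computed from a dataset with counts `n`,
where `p` and `p'` are the MaxEnt distributions of `[f]_R` and `[f]_R'` for the relative
frequencies `f` of the dataset. -/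
noncomputable def entropyStat {ι ι' : Type*} (R : Matrix ι A ℝ) (R' : Matrix ι' A ℝ) (N : ℕ)
    (n : A → ℕ) : ℝ :=
  2 * N * (entropy (maxEnt (eqClass R (relFreq N n))) -
    entropy (maxEnt (eqClass R' (relFreq N n))))

/-- The chi-squared distribution with `k` degrees of freedom: the law of the sum of the squares
of `k` independent standard normal variables (the unit mass at `0` if `k = 0`). -/
noncomputable def chiSquared (k : ℕ) : Measure ℝ :=
  (Measure.pi fun _ : Fin k => gaussianReal 0 1).map fun x => ∑ i, x i ^ 2

open Classical in
/-- The probability that `entropyStat` is at most `x` when the dataset is distributed according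
to `classProb R f N`. -/
noncomputable def statCDF {ι ι' : Type*} (R : Matrix ι A ℝ) (R' : Matrix ι' A ℝ) (f : A → ℝ)
    (N : ℕ) (x : ℝ) : ℝ :=
  ∑ n ∈ (datasets R f N).filter fun n => entropyStat R R' N n ≤ x, classProb R f N n

end MaxEntModel

/-! For `q` in `[f]_R`, the gap between the entropy of the MaxEnt point `p` and that of `q` is the
relative entropy of `q` with respect to `p`, because `log p` is orthogonal to `ker R`
(`IsMaxEnt.relEnt_eq`). A dataset with frequencies `p + z / √N` thus has weight proportional to `exp
(-N * relEnt)`, and `N * relEnt` tends to half of `chiForm p z` for convergent `z`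
(`tendsto_mul_relEnt`).

The admissible counts lie on a shifted lattice in `ker R`. This lattice has full rank because the
real kernel of an integer matrix is spanned by integer vectors (`mem_span_int_of_mulVec_eq_zero`,
`exists_lattice_coords`). Weighted sums over datasets are therefore Riemann sums of Gaussian
integrals (`tendsto_cellVolume_mul_sum`, `tendsto_sum_datasets`): in coordinates orthonormal for
`chiForm p`, the rescaled sample is asymptotically standard Gaussian.

The coordinates can be adapted so that `ker R'` is the vanishing of the first `D' - D` of them
(`exists_adaptedCoords`). Maximizing entropy over `[q]_R'` asymptotically removes the component
along `ker R'`, so the statistic tends to the squared length of the first block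
(`tendsto_mul_relEnt_maxEnt`). Its distribution function is a ratio of two such sums, in which cell
volume and `exp (N * H[p])` cancel, and the limit is `chiSquared_real_Iic_eq_ratio`. The limiting
indicator jumps only on a null set, except when `D' = D`; then the statistic is exactly zero. -/

namespace MaxEntModel

/-! ### Relative entropy: global quadratic lower bound and local expansion -/

open InformationTheory

/-- The function `klFun` dominates the squared Hellinger distance. -/
theorem sq_sqrt_sub_one_le_klFun {t : ℝ} (ht : 0 ≤ t) : (√t - 1) ^ 2 ≤ klFun t := by
  rcases ht.eq_or_lt with rfl | hpos
  · simp [klFun_zero]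
  have hs : 0 < √t := Real.sqrt_pos.2 hpos
  have hsq : √t ^ 2 = t := Real.sq_sqrt ht
  have hlog : Real.log t = 2 * Real.log √t := by
    rw [Real.log_sqrt ht]; ring
  -- Bounding the logarithm at `√t` instead of `t` is what leaves a perfect square: `2 * t * (1 - 1
  -- / √t) + 1 - t = (√t - 1) ^ 2`.
  have h1 := Real.one_sub_inv_le_log_of_pos hs
  have h2 : t * (1 - (√t)⁻¹) ≤ t * Real.log √t := mul_le_mul_of_nonneg_left h1 ht
  have h3 : t * (√t)⁻¹ = √t := by
    rw [← hsq]; field_simp; simp [hsq]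
  rw [klFun_apply, hlog]
  nlinarith

/-- Factor `q - p = (√q - √p) * (√q + √p)`: the first factor is controlled by the Hellinger bound,
the second is at most 2. -/
theorem sq_sub_le_mul_klFun {p q : ℝ} (hp : 0 < p) (hp1 : p ≤ 1) (hq : 0 ≤ q) (hq1 : q ≤ 1) :
    (q - p) ^ 2 / 4 ≤ p * klFun (q / p) := by
  have hqp : 0 ≤ q / p := by positivity
  have h := mul_le_mul_of_nonneg_left (sq_sqrt_sub_one_le_klFun hqp) hp.le
  refine le_trans ?_ h
  set s := √(q / p)
  have hs : q = p * s ^ 2 := by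
    rw [Real.sq_sqrt hqp]; field_simp
  have hs0 : 0 ≤ s := Real.sqrt_nonneg _
  have h4 : p * (s + 1) ^ 2 ≤ 4 := by nlinarith [sq_nonneg (s - 1)]
  have : (q - p) ^ 2 / 4 = p * (s - 1) ^ 2 * (p * (s + 1) ^ 2) / 4 := by
    rw [hs]; ring
  rw [this]
  have h5 : 0 ≤ p * (s - 1) ^ 2 := by positivity
  nlinarith [mul_le_mul_of_nonneg_left h4 h5]

theorem abs_klFun_one_add_sub_le {x : ℝ} (hx : |x| ≤ 1 / 2) :
    |klFun (1 + x) - x ^ 2 / 2| ≤ 4 * |x| ^ 3 := by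
  have h := Real.abs_log_sub_add_sum_range_le (x := -x) (by rw [abs_neg]; linarith) 2
  rw [abs_neg] at h
  simp only [Finset.sum_range_succ, Finset.sum_range_zero, sub_neg_eq_add] at h
  norm_num at h
  set r := -x + x ^ 2 / 2 + Real.log (1 + x) with hr
  have h3 : |x| ^ 3 / (1 - |x|) ≤ 2 * |x| ^ 3 := by
    rw [div_le_iff₀ (by linarith)]
    nlinarith [pow_nonneg (abs_nonneg x) 3]
  have hr2 : |r| ≤ 2 * |x| ^ 3 := h.trans h3
  have hk : klFun (1 + x) - x ^ 2 / 2 = -(x ^ 3 / 2) + (1 + x) * r := by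
    rw [klFun_apply, hr]; ring
  rw [hk]
  have h1x : |1 + x| ≤ 3 / 2 := (abs_add_le _ _).trans (by norm_num; linarith)
  calc |-(x ^ 3 / 2) + (1 + x) * r| ≤ |-(x ^ 3 / 2)| + |(1 + x) * r| := abs_add_le _ _
    _ = |x| ^ 3 / 2 + |1 + x| * |r| := by
        rw [abs_neg, abs_div, abs_pow, abs_mul]; norm_num
    _ ≤ |x| ^ 3 / 2 + 3 / 2 * (2 * |x| ^ 3) := by gcongr
    _ ≤ 4 * |x| ^ 3 := by nlinarith [pow_nonneg (abs_nonneg x) 3]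

variable {A : Type*} [Fintype A]

/-- Relative entropy of `q` with respect to a positive `p`. -/
noncomputable def relEnt (q p : A → ℝ) : ℝ := ∑ α, p α * klFun (q α / p α)

/-- The quadratic form `∑ α, z α ^ 2 / p α`. -/
noncomputable def chiForm (p z : A → ℝ) : ℝ := ∑ α, z α ^ 2 / p α

theorem continuous_chiForm (p : A → ℝ) : Continuous (chiForm p) := by
  unfold chiForm; fun_prop

theorem sum_sq_sub_le_relEnt {p q : A → ℝ} (hp : ∀ α, 0 < p α) (hp1 : ∀ α, p α ≤ 1)
    (hq : ∀ α, 0 ≤ q α) (hq1 : ∀ α, q α ≤ 1) :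
    (∑ α, (q α - p α) ^ 2) / 4 ≤ relEnt q p := by
  rw [relEnt, Finset.sum_div]
  exact Finset.sum_le_sum fun α _ => sq_sub_le_mul_klFun (hp α) (hp1 α) (hq α) (hq1 α)

/-- Expanding `klFun` gives the entropy gap plus two terms linear in `q - p`, which are killed by
`horth` and `hsum`. -/
theorem relEnt_eq {p q : A → ℝ} (hp : ∀ α, 0 < p α) (hsum : ∑ α, q α = ∑ α, p α)
    (horth : ∑ α, (q α - p α) * Real.log (p α) = 0) :
    relEnt q p = entropy p - entropy q := by
  have h : ∀ α, p α * klFun (q α / p α) =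
      (Real.negMulLog (p α) - Real.negMulLog (q α)) - (q α - p α) * Real.log (p α)
        - (q α - p α) := by
    intro α
    have hpα := hp α
    rw [klFun_apply]
    rcases eq_or_ne (q α) 0 with h0 | h0
    · simp [h0, Real.negMulLog]
    · rw [Real.log_div h0 hpα.ne', Real.negMulLog, Real.negMulLog]
      field_simp
      ring
  unfold relEnt entropy
  simp_rw [h, Finset.sum_sub_distrib]
  rw [horth, hsum]
  ring

variable {l : Filter ℕ}

theorem tendsto_inv_sqrt_natCast (hl : l ≤ atTop) :
    Tendsto (fun N : ℕ => (√(N : ℝ))⁻¹) l (𝓝 0) :=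
  (tendsto_inv_atTop_zero.comp
    (Real.tendsto_sqrt_atTop.comp tendsto_natCast_atTop_atTop)).mono_left hl

/-- Along bounded perturbations of order `N⁻¹ᐟ²` the relative entropy, scaled by `N`, is
asymptotically half the chi-squared form. -/
theorem tendsto_mul_relEnt_sub (hl : l ≤ atTop) {p : A → ℝ} (hp : ∀ α, 0 < p α)
    {z : ℕ → A → ℝ} {M : ℝ} (hz : ∀ᶠ N in l, ∀ α, |z N α| ≤ M) :
    Tendsto (fun N : ℕ => N * relEnt (p + (√(N : ℝ))⁻¹ • z N) p - chiForm p (z N) / 2) l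
      (𝓝 0) := by
  have hinv := tendsto_inv_sqrt_natCast hl
  have hterm : ∀ α, Tendsto (fun N : ℕ => N * (p α * klFun ((p α + (√(N : ℝ))⁻¹ * z N α) / p α))
      - z N α ^ 2 / p α / 2) l (𝓝 0) := by
    intro α
    have hpα := hp α
    -- The cubic remainder at `x = z / (√N * p)`, multiplied by `N * p`, is of order `1 / √N`.
    have hb : Tendsto (fun N : ℕ => 4 * M ^ 3 / p α ^ 2 * (√(N : ℝ))⁻¹) l (𝓝 0) := by
      simpa using hinv.const_mul (4 * M ^ 3 / p α ^ 2)
    have hs : Tendsto (fun N : ℕ => (√(N : ℝ))⁻¹ * M / p α) l (𝓝 0) := by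
      simpa using (hinv.mul_const M).div_const (p α)
    refine squeeze_zero_norm' ?_ hb
    filter_upwards [hz, hs.eventually_le_const (show (0 : ℝ) < 1 / 2 by norm_num),
      hl (eventually_gt_atTop 0)] with N hN hsmall hNpos
    have hN' : (0 : ℝ) < N := by exact_mod_cast hNpos
    set s := √(N : ℝ) with hs
    have hs0 : 0 < s := Real.sqrt_pos.2 hN'
    have hss : (N : ℝ) = s ^ 2 := (Real.sq_sqrt hN'.le).symm
    have hzM := hN α
    set x := s⁻¹ * z N α / p α with hx
    have habs : |x| ≤ s⁻¹ * M / p α := by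
      rw [hx, abs_div, abs_mul, abs_of_pos (inv_pos.2 hs0), abs_of_pos hpα]
      gcongr
    have hk := abs_klFun_one_add_sub_le (habs.trans hsmall)
    have h1 : (p α + s⁻¹ * z N α) / p α = 1 + x := by
      rw [hx, add_div, div_self hpα.ne']
    have h2 : z N α ^ 2 / p α / 2 = s ^ 2 * (p α * (x ^ 2 / 2)) := by
      rw [hx]; field_simp
    rw [h1, hss, h2, ← mul_sub, ← mul_sub, Real.norm_eq_abs, abs_mul, abs_mul, abs_of_pos hpα,
      abs_of_nonneg (sq_nonneg s)]
    have hMnn : 0 ≤ M := (abs_nonneg _).trans hzM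
    calc s ^ 2 * (p α * |klFun (1 + x) - x ^ 2 / 2|) ≤ s ^ 2 * (p α * (4 * |x| ^ 3)) := by gcongr
      _ ≤ s ^ 2 * (p α * (4 * (s⁻¹ * M / p α) ^ 3)) := by gcongr
      _ = 4 * M ^ 3 / p α ^ 2 * s⁻¹ := by field_simp
  have hsum := tendsto_finsetSum (Finset.univ : Finset A) fun α _ => hterm α
  simp only [Finset.sum_const_zero] at hsum
  refine hsum.congr fun N => ?_
  simp only [relEnt, chiForm, Finset.mul_sum, Finset.sum_div, Finset.sum_sub_distrib,
    Pi.add_apply, Pi.smul_apply, smul_eq_mul]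

theorem tendsto_mul_relEnt (hl : l ≤ atTop) {p : A → ℝ} (hp : ∀ α, 0 < p α)
    {z : ℕ → A → ℝ} {y : A → ℝ} (hz : Tendsto z l (𝓝 y)) :
    Tendsto (fun N : ℕ => N * relEnt (p + (√(N : ℝ))⁻¹ • z N) p) l (𝓝 (chiForm p y / 2)) := by
  have hb : ∀ᶠ N in l, ∀ α, |z N α| ≤ ‖y‖ + 1 := by
    filter_upwards [hz.norm.eventually_le_const (lt_add_one ‖y‖)] with N hN α
    exact (norm_le_pi_norm (z N) α).trans hN
  have h := (tendsto_mul_relEnt_sub hl hp hb).add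
    ((((continuous_chiForm p).tendsto y).comp hz).div_const 2)
  simpa using h

theorem eventually_nonneg_add (hl : l ≤ atTop) {p : A → ℝ} (hp : ∀ α, 0 < p α)
    {z : ℕ → A → ℝ} {y : A → ℝ} (hz : Tendsto z l (𝓝 y)) :
    ∀ᶠ N : ℕ in l, ∀ α, 0 ≤ (p + (√(N : ℝ))⁻¹ • z N) α := by
  rw [eventually_all]
  intro α
  have h : Tendsto (fun N : ℕ => (p + (√(N : ℝ))⁻¹ • z N) α) l (𝓝 (p α)) := by
    have := ((tendsto_inv_sqrt_natCast hl).mul ((tendsto_pi_nhds.1 hz) α)).const_add (p α)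
    simpa using this
  exact (h.eventually_const_lt (hp α)).mono fun _ h => h.le

end MaxEntModel

/-! ### MaxEnt distributions: positivity and the Pythagorean identity -/

namespace MaxEntModel

variable {A : Type*} [Fintype A]

theorem le_one_of_mem_stdSimplex {q : A → ℝ} (hq : q ∈ stdSimplex ℝ A) (α : A) : q α ≤ 1 :=
  hq.2 ▸ Finset.single_le_sum (fun β _ => hq.1 β) (Finset.mem_univ α)

theorem dotProduct_eq_zero_of_mem_span_row {ι : Type*} {R : Matrix ι A ℝ} {w v : A → ℝ}
    (hw : w ∈ Submodule.span ℝ (Set.range R.row)) (hv : R.mulVec v = 0) : w ⬝ᵥ v = 0 := by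
  induction hw using Submodule.span_induction with
  | mem x hx =>
    obtain ⟨i, rfl⟩ := hx
    exact congrFun hv i
  | zero => simp
  | add x y _ _ hx hy => rw [add_dotProduct, hx, hy, add_zero]
  | smul c x _ hx => rw [smul_dotProduct, hx, smul_zero]

theorem sum_eq_zero_of_mulVec_eq_zero {ι : Type*} {R : Matrix ι A ℝ}
    (hone : (fun _ => 1 : A → ℝ) ∈ Submodule.span ℝ (Set.range R.row)) {v : A → ℝ}
    (hv : R.mulVec v = 0) : ∑ α, v α = 0 := by
  simpa [dotProduct] using dotProduct_eq_zero_of_mem_span_row hone hv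

/-- Entropy has infinite slope at a vanishing coordinate: a step `t` towards `r` gains `-t * r α *
log t` there, while concavity bounds every other loss linearly in `t`. -/
theorem IsMaxEnt.pos {ι : Type*} {R : Matrix ι A ℝ} {f p : A → ℝ}
    (hp : IsMaxEnt (eqClass R f) p) {α : A} (hα : ∃ r ∈ eqClass R f, 0 < r α) : 0 < p α := by
  obtain ⟨r, hr, hrα⟩ := hα
  refine (hp.1.1.1 α).lt_of_ne' fun h0 => ?_
  have key : ∀ t : ℝ, 0 < t → t ≤ 1 → entropy r - entropy p ≤ r α * Real.log t := by
    intro t ht ht1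
    have hmem : (1 - t) • p + t • r ∈ eqClass R f := by
      refine ⟨convex_stdSimplex ℝ A hp.1.1 hr.1 (by linarith) ht.le (by ring), ?_⟩
      rw [Matrix.mulVec_add, Matrix.mulVec_smul, Matrix.mulVec_smul, hp.1.2, hr.2, ← add_smul]
      simp
    have h1 := hp.2 _ hmem
    have h2 : (1 - t) * entropy p + t * entropy r - t * (r α * Real.log t)
        ≤ entropy ((1 - t) • p + t • r) := by
      classical
      have : t * (r α * Real.log t) = ∑ β, if β = α then t * (r α * Real.log t) else 0 := by
        simp
      rw [this]
      unfold entropy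
      rw [Finset.mul_sum, Finset.mul_sum, ← Finset.sum_add_distrib, ← Finset.sum_sub_distrib]
      refine Finset.sum_le_sum fun β _ => ?_
      split_ifs with hβ
      · subst hβ
        have : ((1 - t) • p + t • r) β = t * r β := by simp [h0]
        rw [this, h0, Real.negMulLog_mul]
        simp only [Real.negMulLog]
        apply le_of_eq
        simp
        ring
      · rw [sub_zero]
        exact Real.concaveOn_negMulLog.2 (Set.mem_Ici.2 (hp.1.1.1 β)) (Set.mem_Ici.2 (hr.1.1 β))
          (by linarith) ht.le (by ring)
    nlinarith
  have hlim : Tendsto (fun t : ℝ => r α * Real.log t) (𝓝[>] 0) atBot :=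
    Real.tendsto_log_nhdsGT_zero.const_mul_atBot hrα
  obtain ⟨t, ht, ht0, ht1⟩ := ((hlim.eventually_lt_atBot (entropy r - entropy p)).and
    (Ioc_mem_nhdsGT (zero_lt_one (α := ℝ)))).exists
  exact (key t ht0 ht1).not_gt ht

/-- First-order condition: since `p` is positive, both directions `±v` stay in the class for small
steps, so the derivative of entropy along `v` vanishes. -/
theorem IsMaxEnt.sum_mul_log_eq_zero {ι : Type*} {R : Matrix ι A ℝ} {f p : A → ℝ}
    (hp : IsMaxEnt (eqClass R f) p) (hpos : ∀ α, 0 < p α) {v : A → ℝ}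
    (hv : R.mulVec v = 0) (hsum : ∑ α, v α = 0) : ∑ α, v α * Real.log (p α) = 0 := by
  have hmem : ∀ᶠ t : ℝ in 𝓝 0, p + t • v ∈ eqClass R f := by
    have h : ∀ᶠ t : ℝ in 𝓝 0, ∀ α, 0 < p α + t * v α := by
      rw [eventually_all]
      intro α
      have : Tendsto (fun t : ℝ => p α + t * v α) (𝓝 0) (𝓝 (p α + 0 * v α)) :=
        (by fun_prop : Continuous fun t : ℝ => p α + t * v α).tendsto 0
      exact this.eventually_const_lt (by simpa using hpos α)
    filter_upwards [h] with t ht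
    refine ⟨⟨fun α => (ht α).le, ?_⟩, ?_⟩
    · simp [Finset.sum_add_distrib, ← Finset.mul_sum, hsum, hp.1.1.2]
    · rw [Matrix.mulVec_add, Matrix.mulVec_smul, hv, smul_zero, add_zero, hp.1.2]
  have hmax : IsLocalMax (fun t : ℝ => entropy (p + t • v)) 0 := by
    filter_upwards [hmem] with t ht
    simpa using hp.2 _ ht
  have hder : HasDerivAt (fun t : ℝ => entropy (p + t • v))
      (∑ α, (-Real.log (p α) - 1) * v α) 0 := by
    unfold entropy
    refine HasDerivAt.fun_sum fun α _ => ?_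
    have h1 : HasDerivAt (fun t : ℝ => p α + t * v α) (v α) 0 := by
      simpa using ((hasDerivAt_id (0 : ℝ)).mul_const (v α)).const_add (p α)
    have h2 : HasDerivAt Real.negMulLog (-Real.log (p α) - 1) (p α + 0 * v α) := by
      simpa using Real.hasDerivAt_negMulLog (hpos α).ne'
    exact h2.comp (0 : ℝ) h1
  have h0 := hmax.hasDerivAt_eq_zero hder
  have : ∑ α, (-Real.log (p α) - 1) * v α = -∑ α, v α * Real.log (p α) - ∑ α, v α := by
    rw [← Finset.sum_neg_distrib, ← Finset.sum_sub_distrib]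
    exact Finset.sum_congr rfl fun α _ => by ring
  rw [this, hsum] at h0
  linarith

theorem IsMaxEnt.relEnt_eq {ι : Type*} {R : Matrix ι A ℝ} {f p : A → ℝ}
    (hp : IsMaxEnt (eqClass R f) p) (hpos : ∀ α, 0 < p α) {q : A → ℝ} (hq : q ∈ eqClass R f) :
    relEnt q p = entropy p - entropy q := by
  have hs : ∑ α, q α = ∑ α, p α := by rw [hq.1.2, hp.1.1.2]
  refine MaxEntModel.relEnt_eq hpos hs
    (hp.sum_mul_log_eq_zero hpos (v := q - p) ?_ ?_)
  · rw [Matrix.mulVec_sub, hq.2, hp.1.2, sub_self]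
  · simp [hs]

theorem add_mem_eqClass {ι : Type*} {R : Matrix ι A ℝ}
    (hone : (fun _ => 1 : A → ℝ) ∈ Submodule.span ℝ (Set.range R.row)) {f p v : A → ℝ}
    (hp : p ∈ eqClass R f) (hv : R.mulVec v = 0) (hnn : ∀ α, 0 ≤ (p + v) α) :
    p + v ∈ eqClass R f := by
  refine ⟨⟨hnn, ?_⟩, by rw [Matrix.mulVec_add, hv, add_zero, hp.2]⟩
  simp [Finset.sum_add_distrib, sum_eq_zero_of_mulVec_eq_zero hone hv, hp.1.2]

/-! ### Local asymptotics of the nested MaxEnt entropy -/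

/-- Coordinates `J` on `ker R` that are orthonormal for `chiForm p` and adapted to `ker R'`,
which is the subspace where the coordinates indexed by `κ₁` vanish. -/
structure AdaptedCoords {ι ι' κ₁ κ₂ : Type*} [Fintype κ₁] [Fintype κ₂] (R : Matrix ι A ℝ)
    (R' : Matrix ι' A ℝ) (p : A → ℝ) (J : (κ₁ ⊕ κ₂ → ℝ) →ₗ[ℝ] (A → ℝ)) : Prop where
  chiForm_eq : ∀ a, chiForm p (J a) = ∑ i, a i ^ 2
  mulVec_eq_zero : ∀ a, R.mulVec (J a) = 0
  exists_eq : ∀ v, R.mulVec v = 0 → ∃ a, J a = v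
  mulVec_eq_zero_iff : ∀ a, R'.mulVec (J a) = 0 ↔ ∀ i, a (Sum.inl i) = 0

variable {ι ι' κ₁ κ₂ : Type*} [Fintype κ₁] [Fintype κ₂] {R : Matrix ι A ℝ} {R' : Matrix ι' A ℝ}

/-- Asymptotics of the relative entropy of the MaxEnt distributions of the classes `[q]_R'` with
respect to the one of `[f]_R`, for `q ∈ [f]_R` at distance of order `N⁻¹ᐟ²` of the latter. -/
theorem tendsto_mul_relEnt_maxEnt {l : Filter ℕ} (hl : l ≤ atTop) {f p : A → ℝ}
    (hone : (fun _ => 1 : A → ℝ) ∈ Submodule.span ℝ (Set.range R.row))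
    (himp : ∀ v, R'.mulVec v = 0 → R.mulVec v = 0)
    (hp : IsMaxEnt (eqClass R f) p) (hpos : ∀ α, 0 < p α)
    {J : (κ₁ ⊕ κ₂ → ℝ) →ₗ[ℝ] (A → ℝ)} (hJ : AdaptedCoords R R' p J)
    {b : ℕ → κ₁ ⊕ κ₂ → ℝ} {a : κ₁ ⊕ κ₂ → ℝ} (hb : Tendsto b l (𝓝 a)) :
    Tendsto (fun N : ℕ => N * (entropy p -
      entropy (maxEnt (eqClass R' (p + (√(N : ℝ))⁻¹ • J (b N)))))) l
      (𝓝 ((∑ i, a (Sum.inl i) ^ 2) / 2)) := by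
  have hJc : Continuous J := J.continuous_of_finiteDimensional
  set q : ℕ → A → ℝ := fun N => p + (√(N : ℝ))⁻¹ • J (b N) with hq
  have hqker : ∀ (c : ℝ) u, R.mulVec (c • J u) = 0 := fun c u => by
    rw [Matrix.mulVec_smul, hJ.mulVec_eq_zero, smul_zero]
  have hqmem : ∀ᶠ N in l, q N ∈ eqClass R f := by
    filter_upwards [eventually_nonneg_add hl hpos ((hJc.tendsto a).comp hb)] with N hN
    exact add_mem_eqClass hone hp.1 (hqker _ _) hN
  -- the competitor in `[q N]_R'`
  set c : ℕ → κ₁ ⊕ κ₂ → ℝ := fun N => Sum.elim (fun i => b N (Sum.inl i)) 0 with hc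
  set ca : κ₁ ⊕ κ₂ → ℝ := Sum.elim (fun i => a (Sum.inl i)) 0 with hca
  have hclim : Tendsto c l (𝓝 ca) := by
    rw [tendsto_pi_nhds]
    rintro (i | i)
    · exact (tendsto_pi_nhds.1 hb) (Sum.inl i)
    · exact tendsto_const_nhds
  have hJclim := (hJc.tendsto ca).comp hclim
  have hcq : ∀ N : ℕ, R'.mulVec (p + (√(N : ℝ))⁻¹ • J (c N)) = R'.mulVec (q N) := by
    intro N
    have h : R'.mulVec (J (b N - c N)) = 0 := (hJ.mulVec_eq_zero_iff _).2 fun i => by simp [hc]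
    rw [map_sub, Matrix.mulVec_sub, sub_eq_zero] at h
    simp [hq, Matrix.mulVec_add, Matrix.mulVec_smul, h]
  have hcmem : ∀ᶠ N : ℕ in l, p + (√(N : ℝ))⁻¹ • J (c N) ∈ eqClass R f ∧
      p + (√(N : ℝ))⁻¹ • J (c N) ∈ eqClass R' (q N) := by
    filter_upwards [eventually_nonneg_add hl hpos hJclim] with N hN
    have h := add_mem_eqClass hone hp.1 (hqker _ _) hN
    exact ⟨h, h.1, hcq N⟩
  have hup := tendsto_mul_relEnt hl hpos hJclim
  rw [hJ.chiForm_eq] at hup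
  have hsumc : ∑ i, ca i ^ 2 = ∑ i, a (Sum.inl i) ^ 2 := by simp [hca, Fintype.sum_sum_type]
  rw [hsumc] at hup
  -- coordinates of the maximizer
  have hcoord : ∀ N : ℕ, ∃ w : κ₁ ⊕ κ₂ → ℝ, 0 < N → q N ∈ eqClass R f →
      maxEnt (eqClass R' (q N)) = p + (√(N : ℝ))⁻¹ • J w ∧
        ∀ i, w (Sum.inl i) = b N (Sum.inl i) := by
    intro N
    by_cases hN : 0 < N ∧ q N ∈ eqClass R f
    swap
    · exact ⟨0, fun h1 h2 => absurd ⟨h1, h2⟩ hN⟩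
    have hs : √(N : ℝ) ≠ 0 := (Real.sqrt_pos.2 (by exact_mod_cast hN.1)).ne'
    have hm := isMaxEnt_maxEnt R' hN.2.1
    set p' := maxEnt (eqClass R' (q N))
    have hker : R'.mulVec (√(N : ℝ) • (p' - q N)) = 0 := by
      rw [Matrix.mulVec_smul, Matrix.mulVec_sub, hm.1.2, sub_self, smul_zero]
    obtain ⟨w, hw⟩ := hJ.exists_eq _ (himp _ hker)
    refine ⟨b N + w, fun _ _ => ⟨?_, fun i => ?_⟩⟩
    · rw [map_add, hw, smul_add, smul_smul, inv_mul_cancel₀ hs, one_smul, ← add_assoc]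
      simp [hq]
    · rw [← hw, hJ.mulVec_eq_zero_iff] at hker
      simp [hker i]
  choose w hw using hcoord
  have hgood : ∀ᶠ N : ℕ in l, 0 < N ∧ q N ∈ eqClass R f ∧
      p + (√(N : ℝ))⁻¹ • J (w N) ∈ eqClass R f ∧
      entropy p - entropy (maxEnt (eqClass R' (q N))) = relEnt (p + (√(N : ℝ))⁻¹ • J (w N)) p ∧
      relEnt (p + (√(N : ℝ))⁻¹ • J (w N)) p ≤ relEnt (p + (√(N : ℝ))⁻¹ • J (c N)) p := by
    filter_upwards [hqmem, hcmem, hl (eventually_gt_atTop 0)] with N h1 h2 h3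
    have hm := isMaxEnt_maxEnt R' h1.1
    have hwN := (hw N h3 h1).1
    have h4 : p + (√(N : ℝ))⁻¹ • J (w N) ∈ eqClass R f :=
      add_mem_eqClass hone hp.1 (hqker _ _) (hwN ▸ hm.1.1.1)
    rw [hp.relEnt_eq hpos h4, hp.relEnt_eq hpos h2.1, ← hwN]
    exact ⟨h3, h1, hwN ▸ h4, rfl, sub_le_sub_left (hm.2 _ h2.2) _⟩
  -- Nothing places the maximizer near `p` a priori. Its relative entropy is at most the
  -- competitor's, which is `O(1 / N)`, and the global quadratic lower bound turns this into a
  -- displacement of order `1 / √N`.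
  have hbdd : ∀ᶠ N in l, ∀ α, |J (w N) α| ≤
      √(4 * ((∑ i, a (Sum.inl i) ^ 2) / 2 + 1)) := by
    filter_upwards [hgood, hup.eventually_le_const (lt_add_one _)] with N ⟨h3, _, h4, _, h5⟩ h6 α
    have hN : (0 : ℝ) < N := by exact_mod_cast h3
    have hlow := sum_sq_sub_le_relEnt hpos (le_one_of_mem_stdSimplex hp.1.1) h4.1.1
      (le_one_of_mem_stdSimplex h4.1)
    refine Real.abs_le_sqrt ?_
    have h7 : (J (w N) α) ^ 2 ≤ N * ∑ β, ((p + (√(N : ℝ))⁻¹ • J (w N)) β - p β) ^ 2 := by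
      have h8 : ∀ β, N * ((p + (√(N : ℝ))⁻¹ • J (w N)) β - p β) ^ 2 = J (w N) β ^ 2 := by
        intro β
        simp only [Pi.add_apply, Pi.smul_apply, smul_eq_mul, add_sub_cancel_left, mul_pow, inv_pow,
          Real.sq_sqrt hN.le]
        field_simp
      rw [Finset.mul_sum]
      simp_rw [h8]
      exact Finset.single_le_sum (f := fun β => J (w N) β ^ 2) (fun β _ => sq_nonneg _)
        (Finset.mem_univ α)
    have h9 := mul_le_mul_of_nonneg_left (hlow.trans h5) hN.le
    simp only [Function.comp] at h6
    linarith
  have hlow := (tendsto_mul_relEnt_sub hl hpos hbdd).add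
    (((tendsto_finsetSum (Finset.univ : Finset κ₁) fun i _ =>
      ((tendsto_pi_nhds.1 hb) (Sum.inl i)).pow 2)).div_const 2)
  rw [zero_add] at hlow
  -- Below: the maximizer keeps the first block of `b N`, so its form is at least that block's
  -- squared length. Above: the competitor has zero second block.
  refine tendsto_of_tendsto_of_tendsto_of_le_of_le' hlow hup ?_ ?_
  · filter_upwards [hgood] with N ⟨h1, h2, _, h3, _⟩
    have h4 : ∑ i, b N (Sum.inl i) ^ 2 ≤ ∑ i, w N i ^ 2 := by
      rw [Fintype.sum_sum_type]
      simp_rw [(hw N h1 h2).2]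
      exact le_add_of_nonneg_right (Finset.sum_nonneg fun i _ => sq_nonneg _)
    rw [hJ.chiForm_eq, h3]
    linarith
  · filter_upwards [hgood] with N ⟨h1, h2, _, h3, h4⟩
    rw [h3]
    exact mul_le_mul_of_nonneg_left h4 N.cast_nonneg

end MaxEntModel

/-! ### Riemann sums over shrinking shifted lattices -/

namespace MaxEntModel

variable {ι : Type*}

/-- The cell of scale `√N` containing `a`, in the lattice `T ℤ^ι` shifted by `a₀`. -/
noncomputable def cellIndex (T : (ι → ℝ) ≃ₗ[ℝ] (ι → ℝ)) (a₀ : ι → ℝ) (N : ℕ) (a : ι → ℝ) :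
    ι → ℤ :=
  fun i => ⌊T.symm (√(N : ℝ) • a - a₀) i⌋

/-- The point with index `k` of the lattice `T ℤ^ι` shifted by `a₀`, scaled by `1 / √N`. -/
noncomputable def latticePoint (T : (ι → ℝ) ≃ₗ[ℝ] (ι → ℝ)) (a₀ : ι → ℝ) (N : ℕ) (k : ι → ℤ) :
    ι → ℝ :=
  (√(N : ℝ))⁻¹ • (a₀ + T fun i => (k i : ℝ))

theorem latticePoint_cellIndex (T : (ι → ℝ) ≃ₗ[ℝ] (ι → ℝ)) (a₀ : ι → ℝ) {N : ℕ} (hN : 0 < N)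
    (a : ι → ℝ) : latticePoint T a₀ N (cellIndex T a₀ N a) =
      a - (√(N : ℝ))⁻¹ • T fun i => Int.fract (T.symm (√(N : ℝ) • a - a₀) i) := by
  have hs : √(N : ℝ) ≠ 0 := (Real.sqrt_pos.2 (by exact_mod_cast hN)).ne'
  set u := T.symm (√(N : ℝ) • a - a₀) with hu
  have h1 : (fun i => ((cellIndex T a₀ N a i : ℤ) : ℝ)) = u - fun i => Int.fract (u i) := by
    funext i
    simp [cellIndex, ← hu]
  rw [latticePoint, h1, map_sub, hu, LinearEquiv.apply_symm_apply]
  have h2 : a₀ + (√(N : ℝ) • a - a₀ - T fun i => Int.fract (u i))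
      = √(N : ℝ) • a - T fun i => Int.fract (u i) := by abel
  rw [← hu, h2, smul_sub, smul_smul, inv_mul_cancel₀ hs, one_smul]

variable [Fintype ι]

theorem measurable_cellIndex (T : (ι → ℝ) ≃ₗ[ℝ] (ι → ℝ)) (a₀ : ι → ℝ) (N : ℕ) :
    Measurable (cellIndex T a₀ N) := by
  have hT : Continuous T.symm := T.symm.toLinearMap.continuous_of_finiteDimensional
  refine measurable_pi_lambda _ fun i => Int.measurable_floor.comp ?_
  exact ((continuous_apply i).comp (hT.comp (by fun_prop))).measurable

theorem exists_abs_map_fract_le (T : (ι → ℝ) ≃ₗ[ℝ] (ι → ℝ)) :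
    ∃ M : ℝ, 0 ≤ M ∧ ∀ u : ι → ℝ, ∀ i, |T (fun j => Int.fract (u j)) i| ≤ M := by
  let T' := T.toLinearMap.toContinuousLinearMap
  refine ⟨‖T'‖, norm_nonneg _, fun u i => ?_⟩
  have h1 : ‖fun j => Int.fract (u j)‖ ≤ 1 := by
    rw [pi_norm_le_iff_of_nonneg zero_le_one]
    intro j
    rw [Real.norm_eq_abs, Int.abs_fract]
    exact (Int.fract_lt_one _).le
  calc |T (fun j => Int.fract (u j)) i| ≤ ‖T' fun j => Int.fract (u j)‖ :=
        norm_le_pi_norm (T' fun j => Int.fract (u j)) i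
    _ ≤ ‖T'‖ * ‖fun j => Int.fract (u j)‖ := T'.le_opNorm _
    _ ≤ ‖T'‖ := by nlinarith [norm_nonneg T']

theorem tendsto_latticePoint_cellIndex {l : Filter ℕ} (hl : l ≤ atTop)
    (T : (ι → ℝ) ≃ₗ[ℝ] (ι → ℝ)) (a₀ : ℕ → ι → ℝ) (a : ι → ℝ) :
    Tendsto (fun N => latticePoint T (a₀ N) N (cellIndex T (a₀ N) N a)) l (𝓝 a) := by
  obtain ⟨M, hM, hT⟩ := exists_abs_map_fract_le T
  rw [tendsto_pi_nhds]
  intro i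
  have h := (tendsto_inv_sqrt_natCast hl).mul_const M
  rw [zero_mul] at h
  rw [tendsto_iff_norm_sub_tendsto_zero]
  refine squeeze_zero' (Eventually.of_forall fun _ => norm_nonneg _) ?_ h
  filter_upwards [hl (eventually_gt_atTop 0)] with N hN
  rw [latticePoint_cellIndex T _ hN]
  have : 0 ≤ (√(N : ℝ))⁻¹ := by positivity
  simp only [Pi.sub_apply, Pi.smul_apply, smul_eq_mul, sub_sub_cancel_left, norm_neg, norm_mul,
    Real.norm_eq_abs, abs_of_nonneg this]
  exact mul_le_mul_of_nonneg_left (hT _ i) this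

/-- The common volume of the cells of the scaled lattice `(√N)⁻¹ T ℤ^ι`. -/
noncomputable def cellVolume (T : (ι → ℝ) ≃ₗ[ℝ] (ι → ℝ)) (N : ℕ) : ℝ :=
  |((√(N : ℝ)) ^ Fintype.card ι)⁻¹| * |(LinearMap.det T.toLinearMap)|

theorem cellVolume_pos (T : (ι → ℝ) ≃ₗ[ℝ] (ι → ℝ)) {N : ℕ} (hN : 0 < N) :
    0 < cellVolume T N := by
  have hs : √(N : ℝ) ≠ 0 := (Real.sqrt_pos.2 (by exact_mod_cast hN)).ne'
  have hd : LinearMap.det T.toLinearMap ≠ 0 := T.isUnit_det'.ne_zero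
  unfold cellVolume
  positivity

/-- A cell is the preimage of a unit cube under scaling, translation and `T.symm`, so its volume
depends on neither index nor shift. -/
theorem volume_cellIndex_preimage (T : (ι → ℝ) ≃ₗ[ℝ] (ι → ℝ)) (a₀ : ι → ℝ) {N : ℕ} (hN : 0 < N)
    (k : ι → ℤ) : volume (cellIndex T a₀ N ⁻¹' {k}) = ENNReal.ofReal (cellVolume T N) := by
  have hs : √(N : ℝ) ≠ 0 := (Real.sqrt_pos.2 (by exact_mod_cast hN)).ne'
  have h1 : cellIndex T a₀ N ⁻¹' {k} = (fun a => √(N : ℝ) • a) ⁻¹' ((fun a => a - a₀) ⁻¹'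
      (T.symm ⁻¹' (Set.univ.pi fun i => Set.Ico (k i : ℝ) (k i + 1)))) := by
    ext a
    simp only [Set.mem_preimage, Set.mem_singleton_iff, Set.mem_pi, Set.mem_univ, true_imp_iff,
      funext_iff, cellIndex, Int.floor_eq_iff, Set.mem_Ico]
  rw [h1, Measure.addHaar_preimage_smul _ hs, show (fun a => a - a₀) = fun a => a + -a₀ from
    funext fun a => sub_eq_add_neg a a₀, measure_preimage_add_right,
    Measure.addHaar_preimage_linearEquiv, Real.volume_pi_Ico]
  simp [cellVolume, Module.finrank_fintype_fun_eq_card, ENNReal.ofReal_mul]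

theorem integrable_exp_neg_mul_sum_sq {c : ℝ} (hc : 0 < c) :
    Integrable fun a : ι → ℝ => Real.exp (-c * ∑ i, a i ^ 2) := by
  have h := Integrable.fintype_prod (μ := fun _ : ι => (volume : Measure ℝ))
    (f := fun _ : ι => fun x : ℝ => Real.exp (-c * x ^ 2))
    fun _ => integrable_exp_neg_mul_sq hc
  refine h.congr (Eventually.of_forall fun a => ?_)
  simp only [Finset.mul_sum, Real.exp_sum]

/-- Convergence of Riemann sums over shifted lattices to a Gaussian-dominated integral. -/
theorem tendsto_cellVolume_mul_sum {l : Filter ℕ} [l.IsCountablyGenerated] (hl : l ≤ atTop)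
    (T : (ι → ℝ) ≃ₗ[ℝ] (ι → ℝ)) (a₀ : ℕ → ι → ℝ) (s : ℕ → Finset (ι → ℤ))
    (F : ℕ → (ι → ℤ) → ℝ) (G : (ι → ℝ) → ℝ) {c : ℝ} (hc : 0 < c)
    (hsupp : ∀ᶠ N in l, ∀ k, k ∉ s N → F N k = 0)
    (hbound : ∀ᶠ N in l, ∀ k, |F N k| ≤ Real.exp (-c * ∑ i, latticePoint T (a₀ N) N k i ^ 2))
    (hlim : ∀ᵐ a : ι → ℝ, ∀ k : ℕ → ι → ℤ,
      Tendsto (fun N => latticePoint T (a₀ N) N (k N)) l (𝓝 a) →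
        Tendsto (fun N => F N (k N)) l (𝓝 (G a))) :
    Tendsto (fun N => cellVolume T N * ∑ k ∈ s N, F N k) l (𝓝 (∫ a, G a)) := by
  obtain ⟨M, hM, hT⟩ := exists_abs_map_fract_le T
  -- The sum becomes the integral of a step function constant on cells, so that dominated
  -- convergence applies.
  set Φ : ℕ → (ι → ℝ) → ℝ := fun N a =>
    ∑ k ∈ s N, (cellIndex T (a₀ N) N ⁻¹' {k}).indicator (fun _ => F N k) a with hΦ
  have hmeas : ∀ N k, MeasurableSet (cellIndex T (a₀ N) N ⁻¹' {k}) := fun N k =>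
    measurable_cellIndex T (a₀ N) N (measurableSet_singleton k)
  have hΦeq : ∀ᶠ N in l, ∀ a, Φ N a = F N (cellIndex T (a₀ N) N a) := by
    classical
    filter_upwards [hsupp] with N hN a
    simp only [hΦ, Set.indicator_apply, Set.mem_preimage, Set.mem_singleton_iff]
    rw [Finset.sum_ite_eq]
    split_ifs with h
    · rfl
    · exact (hN _ h).symm
  have hint : ∀ᶠ N in l, ∫ a, Φ N a = cellVolume T N * ∑ k ∈ s N, F N k := by
    filter_upwards [hl (eventually_gt_atTop 0)] with N hN
    have hvol := fun k => volume_cellIndex_preimage T (a₀ N) hN k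
    rw [integral_finsetSum, Finset.mul_sum]
    · refine Finset.sum_congr rfl fun k _ => ?_
      rw [integral_indicator_const _ (hmeas N k), measureReal_def, hvol,
        ENNReal.toReal_ofReal (cellVolume_pos T hN).le, smul_eq_mul]
    · intro k _
      refine (integrable_indicator_iff (hmeas N k)).2 (integrableOn_const ?_)
      rw [hvol]
      exact ENNReal.ofReal_ne_top
  refine Tendsto.congr' hint ?_
  refine tendsto_integral_filter_of_dominated_convergence
    (fun a => Real.exp (-(c / 2) * ∑ i, a i ^ 2) * Real.exp (c * (Fintype.card ι * M ^ 2)))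
    (Eventually.of_forall fun N => ?_) ?_ ?_ ?_
  · exact (Finset.measurable_sum _ fun k _ =>
      measurable_const.indicator (hmeas N k)).aestronglyMeasurable
  · filter_upwards [hΦeq, hbound, hl (eventually_gt_atTop 0)] with N h1 h2 hN
    refine Eventually.of_forall fun a => ?_
    rw [h1, Real.norm_eq_abs]
    refine (h2 _).trans ?_
    rw [← Real.exp_add, Real.exp_le_exp, latticePoint_cellIndex T _ hN]
    set e := T fun i => Int.fract (T.symm (√(N : ℝ) • a - a₀ N) i)
    have hs1 : (√(N : ℝ))⁻¹ ≤ 1 := by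
      apply inv_le_one_of_one_le₀
      rw [Real.one_le_sqrt]
      exact_mod_cast hN
    have hs0 : 0 ≤ (√(N : ℝ))⁻¹ := by positivity
    -- Rounding to the lattice moves each coordinate by at most `M`; halving the Gaussian exponent
    -- absorbs this uniformly in `N`.
    have h3 : ∀ i, a i ^ 2 / 2 - M ^ 2 ≤ (a - (√(N : ℝ))⁻¹ • e) i ^ 2 := by
      intro i
      have he : |(√(N : ℝ))⁻¹ * e i| ≤ M := by
        rw [abs_mul, abs_of_nonneg hs0]
        calc _ ≤ 1 * M := mul_le_mul hs1 (hT _ i) (abs_nonneg _) zero_le_one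
          _ = M := one_mul M
      have he2 : ((√(N : ℝ))⁻¹ * e i) ^ 2 ≤ M ^ 2 := sq_le_sq' (abs_le.1 he).1 (abs_le.1 he).2
      simp only [Pi.sub_apply, Pi.smul_apply, smul_eq_mul]
      nlinarith [sq_nonneg (a i - 2 * ((√(N : ℝ))⁻¹ * e i))]
    have h4 := Finset.sum_le_sum fun i (_ : i ∈ Finset.univ) => h3 i
    rw [Finset.sum_sub_distrib, ← Finset.sum_div, Finset.sum_const, Finset.card_univ,
      nsmul_eq_mul] at h4
    nlinarith
  · exact (integrable_exp_neg_mul_sum_sq (half_pos hc)).mul_const _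
  · filter_upwards [hlim] with a ha
    refine (ha _ (tendsto_latticePoint_cellIndex hl T a₀ a)).congr' ?_
    filter_upwards [hΦeq] with N hN
    rw [hN]

/-- The unnormalized standard Gaussian density. -/
noncomputable def gaussWeight {ι : Type*} [Fintype ι] (a : ι → ℝ) : ℝ :=
  Real.exp (-(∑ i, a i ^ 2) / 2)

end MaxEntModel

/-! ### Gaussian integrals and the chi-squared law -/

namespace MaxEntModel

variable {ι κ₁ κ₂ : Type*} [Fintype ι] [Fintype κ₁] [Fintype κ₂]

theorem integrable_gaussWeight : Integrable (gaussWeight (ι := ι)) := by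
  refine (integrable_exp_neg_mul_sum_sq (ι := ι) (c := 1 / 2) (by norm_num)).congr
    (Eventually.of_forall fun a => ?_)
  simp only [gaussWeight]
  congr 1
  ring

theorem integral_gaussWeight_pos : 0 < ∫ a : ι → ℝ, gaussWeight a :=
  integral_exp_pos (f := fun a : ι → ℝ => -(∑ i, a i ^ 2) / 2) integrable_gaussWeight

theorem prod_gaussianPDFReal (a : ι → ℝ) :
    ∏ i, gaussianPDFReal 0 1 (a i) = (√(2 * Real.pi))⁻¹ ^ Fintype.card ι * gaussWeight a := by
  simp only [gaussianPDFReal, gaussWeight, Finset.prod_mul_distrib, Finset.prod_const,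
    Finset.card_univ, NNReal.coe_one, mul_one, sub_zero, ← Real.exp_sum, ← Finset.sum_div,
    Finset.sum_neg_distrib]

theorem pi_gaussianReal_eq_withDensity :
    Measure.pi (fun _ : ι => gaussianReal 0 1) = (volume : Measure (ι → ℝ)).withDensity
      fun a => ENNReal.ofReal (∏ i, gaussianPDFReal 0 1 (a i)) := by
  refine Measure.pi_eq fun s hs => ?_
  have hnn : ∀ a : ι → ℝ, 0 ≤ ∏ i, gaussianPDFReal 0 1 (a i) := fun a =>
    Finset.prod_nonneg fun i _ => gaussianPDFReal_nonneg _ _ _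
  have hint : Integrable fun a : ι → ℝ => ∏ i, gaussianPDFReal 0 1 (a i) := by
    simp_rw [prod_gaussianPDFReal]
    exact integrable_gaussWeight.const_mul _
  rw [withDensity_apply _ (MeasurableSet.univ_pi hs),
    ← ofReal_integral_eq_lintegral_ofReal hint.integrableOn (Eventually.of_forall hnn),
    volume_pi, Measure.restrict_pi_pi,
    integral_fintype_prod_eq_prod (fun _ : ι => gaussianPDFReal 0 1),
    ENNReal.ofReal_prod_of_nonneg fun i _ => integral_nonneg fun x => gaussianPDFReal_nonneg _ _ _]
  exact Finset.prod_congr rfl fun i _ => (gaussianReal_apply_eq_integral 0 one_ne_zero (s i)).symm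

theorem pi_gaussianReal_real_apply {s : Set (ι → ℝ)} (hs : MeasurableSet s) :
    (Measure.pi fun _ : ι => gaussianReal 0 1).real s =
      (∫ a in s, gaussWeight a) / ∫ a : ι → ℝ, gaussWeight a := by
  have key : ∀ {t : Set (ι → ℝ)}, MeasurableSet t →
      (Measure.pi fun _ : ι => gaussianReal 0 1).real t =
        (√(2 * Real.pi))⁻¹ ^ Fintype.card ι * ∫ a in t, gaussWeight a := by
    intro t ht
    rw [measureReal_def, pi_gaussianReal_eq_withDensity, withDensity_apply _ ht]
    simp_rw [prod_gaussianPDFReal]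
    rw [← integral_const_mul, ← ofReal_integral_eq_lintegral_ofReal
      (integrable_gaussWeight.const_mul _).integrableOn, ENNReal.toReal_ofReal]
    · exact integral_nonneg fun a => mul_nonneg (by positivity) (Real.exp_pos _).le
    · exact Eventually.of_forall fun a => mul_nonneg (by positivity) (Real.exp_pos _).le
  -- Total mass one identifies the normalizing constant, so the Gaussian integral need not be
  -- evaluated.
  have h1 := key MeasurableSet.univ
  rw [probReal_univ, setIntegral_univ] at h1
  rw [key hs, eq_div_iff integral_gaussWeight_pos.ne', mul_right_comm, ← h1, one_mul]

theorem measurable_sum_sq : Measurable fun a : ι → ℝ => ∑ i, a i ^ 2 := by fun_prop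

theorem chiSquared_real_Iic (k : ℕ) (x : ℝ) : (chiSquared k).real (Set.Iic x) =
    (∫ a in {a : Fin k → ℝ | ∑ i, a i ^ 2 ≤ x}, gaussWeight a) /
      ∫ a : Fin k → ℝ, gaussWeight a := by
  rw [chiSquared, map_measureReal_apply measurable_sum_sq measurableSet_Iic]
  exact pi_gaussianReal_real_apply (measurable_sum_sq measurableSet_Iic)

theorem gaussWeight_sum (a : κ₁ ⊕ κ₂ → ℝ) : gaussWeight a =
    gaussWeight (fun i => a (Sum.inl i)) * gaussWeight (fun i => a (Sum.inr i)) := by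
  rw [gaussWeight, gaussWeight, gaussWeight, ← Real.exp_add, Fintype.sum_sum_type]
  congr 1
  ring

theorem integral_sum_type_mul (φ : (κ₁ → ℝ) → ℝ) (ψ : (κ₂ → ℝ) → ℝ) :
    ∫ a : κ₁ ⊕ κ₂ → ℝ, φ (fun i => a (Sum.inl i)) * ψ (fun i => a (Sum.inr i)) =
      (∫ u, φ u) * ∫ v, ψ v := by
  rw [← integral_prod_mul]
  exact (volume_measurePreserving_sumPiEquivProdPi fun _ : κ₁ ⊕ κ₂ => ℝ).integral_comp'
    (g := fun z : (κ₁ → ℝ) × (κ₂ → ℝ) => φ z.1 * ψ z.2)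

/-- The squared length of the first block of coordinates of a standard Gaussian vector has the
chi-squared distribution. -/
theorem chiSquared_real_Iic_eq_ratio (k : ℕ) (x : ℝ) : (chiSquared k).real (Set.Iic x) =
    (∫ a : Fin k ⊕ κ₂ → ℝ, {a | ∑ i, a (Sum.inl i) ^ 2 ≤ x}.indicator gaussWeight a) /
      ∫ a : Fin k ⊕ κ₂ → ℝ, gaussWeight a := by
  have h1 : ∀ a : Fin k ⊕ κ₂ → ℝ, {a | ∑ i, a (Sum.inl i) ^ 2 ≤ x}.indicator gaussWeight a =
      {u : Fin k → ℝ | ∑ i, u i ^ 2 ≤ x}.indicator gaussWeight (fun i => a (Sum.inl i)) *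
        gaussWeight (fun i => a (Sum.inr i)) := by
    intro a
    simp only [Set.indicator_apply, Set.mem_ofPred_eq, gaussWeight_sum a]
    split_ifs <;> simp
  simp_rw [h1, gaussWeight_sum (κ₁ := Fin k) (κ₂ := κ₂)]
  rw [integral_sum_type_mul, integral_sum_type_mul gaussWeight gaussWeight,
    mul_div_mul_right _ _ integral_gaussWeight_pos.ne', chiSquared_real_Iic,
    ← integral_indicator (show MeasurableSet {u : Fin k → ℝ | ∑ i, u i ^ 2 ≤ x} from
      measurable_sum_sq measurableSet_Iic)]

/-- Spheres are null in positive dimension. In dimension zero the level `x = 0` would be the whole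
space. -/
theorem volume_sum_sq_eq_zero [Nonempty κ₁] (x : ℝ) :
    volume {a : κ₁ → ℝ | ∑ i, a i ^ 2 = x} = 0 := by
  have h : {a : κ₁ → ℝ | ∑ i, a i ^ 2 = x} ⊆
      WithLp.toLp 2 ⁻¹' (Metric.sphere (0 : EuclideanSpace ℝ κ₁) √x) := by
    intro a ha
    simp [EuclideanSpace.norm_eq, ← ha.out]
  refine measure_mono_null h ?_
  exact ((EuclideanSpace.volume_preserving_symm_measurableEquiv_toLp κ₁).symm.measure_preimage
    Metric.isClosed_sphere.measurableSet.nullMeasurableSet).trans (Measure.addHaar_sphere _ _ _)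

theorem ae_sum_inl_sq_ne [Nonempty κ₁] (x : ℝ) :
    ∀ᵐ a : κ₁ ⊕ κ₂ → ℝ, ∑ i, a (Sum.inl i) ^ 2 ≠ x := by
  have h1 : ∀ᵐ z : (κ₁ → ℝ) × (κ₂ → ℝ), ∑ i, z.1 i ^ 2 ≠ x := by
    have h2 : ∀ᵐ u : κ₁ → ℝ, ∑ i, u i ^ 2 ≠ x := by
      rw [ae_iff]
      simpa using volume_sum_sq_eq_zero x
    exact (Measure.quasiMeasurePreserving_fst (μ := (volume : Measure (κ₁ → ℝ)))
      (ν := (volume : Measure (κ₂ → ℝ)))).ae h2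
  exact (volume_measurePreserving_sumPiEquivProdPi fun _ : κ₁ ⊕ κ₂ => ℝ).quasiMeasurePreserving.ae h1

end MaxEntModel

/-! ### Integer points of the kernel and adapted coordinates -/

namespace MaxEntModel

variable {A κ : Type*} [Fintype A]

/-- The real kernel of an integer matrix is spanned by integer vectors. -/
theorem mem_span_int_of_mulVec_eq_zero (C : Matrix κ A ℤ) {v : A → ℝ}
    (hv : (C.map (Int.cast : ℤ → ℝ)).mulVec v = 0) :
    v ∈ Submodule.span ℝ {w : A → ℝ | (C.map (Int.cast : ℤ → ℝ)).mulVec w = 0 ∧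
      ∃ n : A → ℤ, w = fun α => (n α : ℝ)} := by
  classical
  -- Integer relations among the real entries of `v` hold coordinatewise in a `ℚ`-basis of their
  -- span. Each coordinate gives a rational kernel vector, made integral by clearing denominators.
  let E : Submodule ℚ ℝ := Submodule.span ℚ (Set.range v)
  have : FiniteDimensional ℚ E := FiniteDimensional.span_of_finite ℚ (Set.finite_range v)
  let e := Module.finBasis ℚ E
  let u : A → E := fun α => ⟨v α, Submodule.subset_span ⟨α, rfl⟩⟩
  have hint : ∀ i, ∃ M : ℤ, M ≠ 0 ∧ ∃ n : A → ℤ, ∀ α, (n α : ℚ) = M * e.repr (u α) i := by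
    intro i
    obtain ⟨M, hM⟩ := IsLocalization.exist_integer_multiples_of_finite (nonZeroDivisors ℤ)
      (fun α => e.repr (u α) i)
    choose n hn using hM
    exact ⟨M, nonZeroDivisors.coe_ne_zero M, n, fun α => by simpa using hn α⟩
  choose M hM n hn using hint
  have hrow : ∀ c, ∑ α, (C c α : ℚ) • u α = 0 := by
    intro c
    apply Subtype.ext
    have h := congrFun hv c
    simp only [Matrix.mulVec, dotProduct, Matrix.map_apply, Pi.zero_apply] at h
    simp only [Submodule.coe_sum, Submodule.coe_smul, Submodule.coe_zero, u, ← h]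
    refine Finset.sum_congr rfl fun α _ => ?_
    rw [Rat.smul_def]
    simp
  have hker : ∀ i, (C.map (Int.cast : ℤ → ℝ)).mulVec (fun α => (n i α : ℝ)) = 0 := by
    intro i
    funext c
    have h := congrArg (fun x => (M i : ℚ) * e.repr x i) (hrow c)
    simp only [map_sum, map_smul, Finsupp.coe_finsetSum, Finset.sum_apply, Finsupp.smul_apply,
      smul_eq_mul, map_zero, Finsupp.coe_zero, Pi.zero_apply, mul_zero, Finset.mul_sum] at h
    have h2 : ∑ α, (C c α : ℚ) * (n i α : ℚ) = 0 := by
      rw [← h]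
      refine Finset.sum_congr rfl fun α _ => ?_
      rw [hn]
      ring
    simp only [Matrix.mulVec, dotProduct, Matrix.map_apply, Pi.zero_apply]
    exact_mod_cast h2
  have hsum : v = ∑ i, ((e i : ℝ) / M i) • fun α => (n i α : ℝ) := by
    funext α
    have h := congrArg (Subtype.val) (e.sum_repr (u α))
    simp only [Submodule.coe_sum, Submodule.coe_smul, u] at h
    rw [← h, Finset.sum_apply]
    refine Finset.sum_congr rfl fun i _ => ?_
    have hMi : (M i : ℝ) ≠ 0 := by exact_mod_cast hM i
    have h3 : (n i α : ℝ) = M i * (e.repr (u α) i : ℝ) := by exact_mod_cast hn i α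
    rw [Pi.smul_apply, h3, Rat.smul_def, smul_eq_mul]
    field_simp
    exact mul_comm _ _
  rw [hsum]
  exact Submodule.sum_mem _ fun i _ => Submodule.smul_mem _ _
    (Submodule.subset_span ⟨hker i, n i, rfl⟩)

/-- If the range of an injective linear map is spanned by integer vectors, the integer vectors of
the range form a lattice in its coordinates. -/
theorem exists_lattice_coords {ι : Type*} [Fintype ι] {J : (ι → ℝ) →ₗ[ℝ] (A → ℝ)}
    (hinj : Function.Injective J)
    (hspan : ∀ a, J a ∈ Submodule.span ℝ
      {w : A → ℝ | w ∈ LinearMap.range J ∧ ∃ n : A → ℤ, w = fun α => (n α : ℝ)}) :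
    ∃ T : (ι → ℝ) ≃ₗ[ℝ] (ι → ℝ), ∀ a, (∃ n : A → ℤ, J a = fun α => (n α : ℝ)) ↔
      ∃ k : ι → ℤ, a = T fun i => (k i : ℝ) := by
  classical
  let L₀ : Submodule ℤ (A → ℝ) := Submodule.span ℤ (Set.range (Pi.basisFun ℝ A))
  have hL₀ : ∀ w, w ∈ L₀ ↔ ∃ n : A → ℤ, w = fun α => (n α : ℝ) := by
    intro w
    rw [Module.Basis.mem_span_iff_repr_mem]
    simp only [Pi.basisFun_repr, Set.mem_range, algebraMap_int_eq, Int.coe_castRingHom]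
    constructor
    · intro h
      choose n hn using h
      exact ⟨n, funext fun α => (hn α).symm⟩
    · rintro ⟨n, rfl⟩ α
      exact ⟨n α, rfl⟩
  let L : Submodule ℤ (ι → ℝ) := ZLattice.comap ℝ L₀ J
  have hL : ∀ a, a ∈ L ↔ ∃ n : A → ℤ, J a = fun α => (n α : ℝ) := fun a => hL₀ (J a)
  have : DiscreteTopology L :=
    ZLattice.comap_discreteTopology ℝ L₀ J.continuous_of_finiteDimensional hinj
  -- Full rank is where `hspan` enters; discreteness needed only injectivity. A `ℤ`-basis of `L`
  -- then provides `T`.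
  have : IsZLattice ℝ L := by
    refine ⟨eq_top_iff.2 fun a _ => ?_⟩
    have h : J a ∈ (Submodule.span ℝ (L : Set (ι → ℝ))).map J := by
      refine Submodule.span_le.2 ?_ (hspan a)
      rintro _ ⟨⟨b, rfl⟩, n, hn⟩
      exact ⟨b, Submodule.subset_span ((hL b).2 ⟨n, hn⟩), rfl⟩
    obtain ⟨b, hb, hba⟩ := h
    exact hinj hba ▸ hb
  have := ZLattice.module_free ℝ L
  have := ZLattice.module_finite ℝ L
  have hrank : Module.finrank ℤ L = Fintype.card ι := by
    rw [ZLattice.rank ℝ L, Module.finrank_fintype_fun_eq_card]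
  let b : Module.Basis ι ℤ L := (Module.finBasisOfFinrankEq ℤ L hrank).reindex
    (Fintype.equivFin ι).symm
  let bR := b.ofZLatticeBasis ℝ L
  refine ⟨bR.equivFun.symm, fun a => ?_⟩
  rw [← hL, ← b.ofZLatticeBasis_span ℝ (L := L), Submodule.mem_span_range_iff_exists_fun]
  refine exists_congr fun k => ?_
  rw [Module.Basis.equivFun_symm_apply, eq_comm]
  simp only [Int.cast_smul_eq_zsmul, bR]

theorem finrank_ker_add_rank {ι : Type*} [Fintype ι] (R : Matrix ι A ℝ) :
    Module.finrank ℝ (LinearMap.ker R.mulVecLin) + R.rank = Fintype.card A := by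
  rw [Matrix.rank, add_comm, LinearMap.finrank_range_add_finrank_ker,
    Module.finrank_fintype_fun_eq_card]

/-- The linear equivalence turning `chiForm p` into the squared Euclidean norm. -/
noncomputable def whiten {p : A → ℝ} (hp : ∀ α, 0 < p α) : (A → ℝ) ≃ₗ[ℝ] EuclideanSpace ℝ A :=
  (LinearEquiv.piCongrRight fun α =>
    LinearEquiv.smulOfNeZero ℝ ℝ (√(p α))⁻¹ (inv_ne_zero (Real.sqrt_pos.2 (hp α)).ne')).trans
    (WithLp.linearEquiv 2 ℝ (A → ℝ)).symm

theorem chiForm_eq_norm_sq {p : A → ℝ} (hp : ∀ α, 0 < p α) (z : A → ℝ) :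
    chiForm p z = ‖whiten hp z‖ ^ 2 := by
  rw [EuclideanSpace.norm_sq_eq, chiForm]
  refine Finset.sum_congr rfl fun α _ => ?_
  have : whiten hp z α = (√(p α))⁻¹ * z α := rfl
  rw [this, Real.norm_eq_abs, sq_abs, mul_pow, inv_pow, Real.sq_sqrt (hp α).le]
  ring

theorem exists_adaptedCoords {D D' : ℕ} {R : Matrix (Fin D) A ℝ} {R' : Matrix (Fin D') A ℝ}
    (hR : R.rank = D) (hR' : R'.rank = D')
    (himp : ∀ v, R'.mulVec v = 0 → R.mulVec v = 0) {p : A → ℝ} (hp : ∀ α, 0 < p α) :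
    ∃ (m : ℕ) (J : (Fin (D' - D) ⊕ Fin m → ℝ) →ₗ[ℝ] (A → ℝ)), AdaptedCoords R R' p J := by
  set σ := whiten hp
  set V := LinearMap.ker R.mulVecLin with hV
  set W := LinearMap.ker R'.mulVecLin with hW
  have hWV : W ≤ V := fun v hv => by
    simpa [hV] using himp v (by simpa [hW] using hv)
  set V' := V.map σ.toLinearMap with hV'
  set W' := W.map σ.toLinearMap with hW'
  have hWV' : W' ≤ V' := Submodule.map_mono hWV
  set U := W'ᗮ ⊓ V' with hU
  -- Rank-nullity with `W' ≤ V'` forces `D ≤ D'`, so the truncated subtraction is a true difference.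
  have hfU : Module.finrank ℝ U = D' - D := by
    have h1 := Submodule.finrank_add_inf_finrank_orthogonal hWV'
    have h2 := finrank_ker_add_rank R
    have h3 := finrank_ker_add_rank R'
    have h4 : Module.finrank ℝ V' = Module.finrank ℝ V := σ.finrank_map_eq V
    have h5 : Module.finrank ℝ W' = Module.finrank ℝ W := σ.finrank_map_eq W
    rw [← hU] at h1
    rw [← hV] at h2
    rw [← hW] at h3
    omega
  let bU := (stdOrthonormalBasis ℝ U).reindex (finCongr hfU)
  let bW := stdOrthonormalBasis ℝ W'
  let mU : (Fin (D' - D) → ℝ) ≃ₗ[ℝ] U :=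
    (WithLp.linearEquiv 2 ℝ (Fin (D' - D) → ℝ)).symm.trans bU.repr.symm.toLinearEquiv
  let mW : (Fin (Module.finrank ℝ W') → ℝ) ≃ₗ[ℝ] W' :=
    (WithLp.linearEquiv 2 ℝ (Fin _ → ℝ)).symm.trans bW.repr.symm.toLinearEquiv
  have hmU : ∀ a, ‖mU a‖ ^ 2 = ∑ i, a i ^ 2 := by
    intro a
    have : ‖mU a‖ = ‖WithLp.toLp 2 a‖ := bU.repr.symm.norm_map _
    rw [this, EuclideanSpace.norm_sq_eq]
    simp
  have hmW : ∀ a, ‖mW a‖ ^ 2 = ∑ i, a i ^ 2 := by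
    intro a
    have : ‖mW a‖ = ‖WithLp.toLp 2 a‖ := bW.repr.symm.norm_map _
    rw [this, EuclideanSpace.norm_sq_eq]
    simp
  let K : (Fin (D' - D) ⊕ Fin (Module.finrank ℝ W') → ℝ) →ₗ[ℝ] EuclideanSpace ℝ A :=
    U.subtype ∘ₗ mU.toLinearMap ∘ₗ LinearMap.funLeft ℝ ℝ Sum.inl +
      W'.subtype ∘ₗ mW.toLinearMap ∘ₗ LinearMap.funLeft ℝ ℝ Sum.inr
  have hK : ∀ a, K a = (mU fun i => a (Sum.inl i) : EuclideanSpace ℝ A) +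
      (mW fun i => a (Sum.inr i) : EuclideanSpace ℝ A) := fun a => rfl
  have hσV : ∀ v, R.mulVec v = 0 ↔ σ v ∈ V' := by
    intro v
    rw [hV', Submodule.mem_map_equiv]
    simp [hV]
  have hσW : ∀ v, R'.mulVec v = 0 ↔ σ v ∈ W' := by
    intro v
    rw [hW', Submodule.mem_map_equiv]
    simp [hW]
  have hKV : ∀ a, K a ∈ V' := fun a => by
    rw [hK]
    exact add_mem (mU _).2.2 (hWV' (mW _).2)
  refine ⟨Module.finrank ℝ W', σ.symm.toLinearMap ∘ₗ K, ⟨fun a => ?_, fun a => ?_, fun v hv => ?_,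
    fun a => ?_⟩⟩
  · rw [chiForm_eq_norm_sq hp]
    have h1 : whiten hp ((σ.symm.toLinearMap ∘ₗ K) a) = K a := σ.apply_symm_apply _
    have h2 := norm_add_sq_eq_norm_sq_add_norm_sq_real
      (Submodule.inner_left_of_mem_orthogonal (mW fun i => a (Sum.inr i)).2
        (mU fun i => a (Sum.inl i)).2.1)
    rw [h1, hK, sq, h2, ← sq, ← sq, ← Submodule.coe_norm, ← Submodule.coe_norm, hmU, hmW,
      Fintype.sum_sum_type]
  · rw [hσV]
    simpa using hKV a
  · have h1 : σ v ∈ W' ⊔ U := by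
      rw [hU, Submodule.sup_orthogonal_inf_of_hasOrthogonalProjection hWV']
      exact (hσV v).1 hv
    obtain ⟨w, hw, u, hu, hwu⟩ := Submodule.mem_sup.1 h1
    refine ⟨Sum.elim (mU.symm ⟨u, hu⟩) (mW.symm ⟨w, hw⟩), ?_⟩
    have h2 : K (Sum.elim (mU.symm ⟨u, hu⟩) (mW.symm ⟨w, hw⟩)) = σ v := by
      rw [hK, ← hwu, add_comm]
      simp
    simp [h2]
  · rw [hσW]
    have h1 : σ ((σ.symm.toLinearMap ∘ₗ K) a) = K a := σ.apply_symm_apply _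
    rw [h1, hK, Submodule.add_mem_iff_left _ (mW _).2]
    constructor
    · intro h
      have h2 : ((mU fun i => a (Sum.inl i)) : EuclideanSpace ℝ A) = 0 :=
        inner_self_eq_zero.1 (Submodule.inner_right_of_mem_orthogonal h (mU _).2.1)
      have h3 : (mU fun i => a (Sum.inl i)) = 0 := Subtype.ext h2
      intro i
      exact congrFun (mU.map_eq_zero_iff.1 h3) i
    · intro h
      have h2 : (fun i => a (Sum.inl i)) = (0 : Fin (D' - D) → ℝ) := funext h
      rw [h2, map_zero]
      exact zero_mem _

end MaxEntModel

/-! ### Sums over datasets and the limit of the distribution function -/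

namespace MaxEntModel

variable {A : Type*} [Fintype A]

theorem mulVec_eq_zero_of_span_row_le {ι ι' : Type*} {R : Matrix ι A ℝ} {R' : Matrix ι' A ℝ}
    (h : Submodule.span ℝ (Set.range R.row) ≤ Submodule.span ℝ (Set.range R'.row)) {v : A → ℝ}
    (hv : R'.mulVec v = 0) : R.mulVec v = 0 :=
  funext fun i => dotProduct_eq_zero_of_mem_span_row
    (h (Submodule.subset_span (Set.mem_range_self i))) hv

theorem IsEmpirical.mem_stdSimplex {f : A → ℝ} (hf : IsEmpirical f) : f ∈ stdSimplex ℝ A := by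
  obtain ⟨N, n, hN, hsum, rfl⟩ := hf
  refine ⟨fun α => by unfold relFreq; positivity, ?_⟩
  have : (N : ℝ) ≠ 0 := by exact_mod_cast hN.ne'
  simp only [relFreq]
  rw [← Finset.sum_div, ← Nat.cast_sum, hsum, div_self this]

theorem mem_datasets {ι : Type*} {R : Matrix ι A ℝ} {f : A → ℝ} {N : ℕ} {n : A → ℕ} :
    n ∈ datasets R f N ↔ ∑ α, n α = N ∧ relFreq N n ∈ eqClass R f := by
  simp [datasets]

theorem pos_of_mem_datasets {ι : Type*} {R : Matrix ι A ℝ} {f : A → ℝ} {N : ℕ} {n : A → ℕ}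
    (hn : n ∈ datasets R f N) : 0 < N := by
  rcases Nat.eq_zero_or_pos N with rfl | h
  · have := (mem_datasets.1 hn).2.1.2
    simp [relFreq] at this
  · exact h

theorem eqClass_congr {ι : Type*} {R : Matrix ι A ℝ} {f g : A → ℝ}
    (h : R.mulVec f = R.mulVec g) : eqClass R f = eqClass R g := by
  simp only [eqClass, h]

namespace AdaptedCoords

variable {ι ι' κ₁ κ₂ : Type*} [Fintype κ₁] [Fintype κ₂] {R : Matrix ι A ℝ} {R' : Matrix ι' A ℝ}
  {p : A → ℝ} {J : (κ₁ ⊕ κ₂ → ℝ) →ₗ[ℝ] (A → ℝ)}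

theorem injective (hJ : AdaptedCoords R R' p J) : Function.Injective J := by
  rw [injective_iff_map_eq_zero]
  intro a ha
  have h := hJ.chiForm_eq a
  rw [ha, show chiForm p 0 = 0 by simp [chiForm], eq_comm,
    Finset.sum_eq_zero_iff_of_nonneg fun i _ => sq_nonneg (a i)] at h
  exact funext fun i => pow_eq_zero_iff two_ne_zero |>.1 (h i (Finset.mem_univ i))

/-- This is the Gaussian domination for the Riemann sums. It holds on the whole simplex, not just
near `p`, so no separate tail estimate is required. -/
theorem exp_neg_mul_relEnt_le (hJ : AdaptedCoords R R' p J) (hpos : ∀ α, 0 < p α)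
    (hp1 : ∀ α, p α ≤ 1) {δ : ℝ} (hδ : ∀ α, δ ≤ p α) {N : ℕ} (hN : 0 < N) {b : κ₁ ⊕ κ₂ → ℝ}
    (hq : p + (√(N : ℝ))⁻¹ • J b ∈ stdSimplex ℝ A) :
    Real.exp (-(N * relEnt (p + (√(N : ℝ))⁻¹ • J b) p)) ≤
      Real.exp (-(δ / 4) * ∑ i, b i ^ 2) := by
  have hN' : (0 : ℝ) < N := by exact_mod_cast hN
  have h := mul_le_mul_of_nonneg_left
    (sum_sq_sub_le_relEnt hpos hp1 hq.1 (le_one_of_mem_stdSimplex hq)) hN'.le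
  have h1 : N * ((∑ α, ((p + (√(N : ℝ))⁻¹ • J b) α - p α) ^ 2) / 4) = (∑ α, J b α ^ 2) / 4 := by
    rw [← mul_div_assoc, Finset.mul_sum]
    congr 1
    refine Finset.sum_congr rfl fun α _ => ?_
    simp only [Pi.add_apply, Pi.smul_apply, smul_eq_mul, add_sub_cancel_left, mul_pow, inv_pow,
      Real.sq_sqrt hN'.le]
    field_simp
  have h2 : δ * ∑ i, b i ^ 2 ≤ ∑ α, J b α ^ 2 := by
    rw [← hJ.chiForm_eq, chiForm, Finset.mul_sum]
    refine Finset.sum_le_sum fun α _ => ?_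
    rw [← mul_div_assoc, div_le_iff₀ (hpos α), mul_comm]
    exact mul_le_mul_of_nonneg_left (hδ α) (sq_nonneg _)
  rw [Real.exp_le_exp]
  linarith

end AdaptedCoords

/-- Asymptotics of exponentially weighted sums over the datasets in `[f]_R`. -/
theorem tendsto_sum_datasets {ι ι' κ₁ κ₂ : Type*} [Fintype κ₁] [Fintype κ₂] {R : Matrix ι A ℝ}
    {R' : Matrix ι' A ℝ} {f p : A → ℝ}
    (hone : (fun _ => 1 : A → ℝ) ∈ Submodule.span ℝ (Set.range R.row))
    (hp : IsMaxEnt (eqClass R f) p) (hpos : ∀ α, 0 < p α)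
    {J : (κ₁ ⊕ κ₂ → ℝ) →ₗ[ℝ] (A → ℝ)} (hJ : AdaptedCoords R R' p J)
    {T : (κ₁ ⊕ κ₂ → ℝ) ≃ₗ[ℝ] (κ₁ ⊕ κ₂ → ℝ)}
    (hT : ∀ a, (∃ n : A → ℤ, J a = fun α => (n α : ℝ)) ↔
      ∃ k : κ₁ ⊕ κ₂ → ℤ, a = T fun i => (k i : ℝ))
    {l : Filter ℕ} [l.IsCountablyGenerated] (hl : l ≤ atTop)
    (hne : ∀ᶠ N in l, (datasets R f N).Nonempty)
    (χ : ℕ → (A → ℝ) → ℝ) (hχ : ∀ N q, |χ N q| ≤ 1) (X : (κ₁ ⊕ κ₂ → ℝ) → ℝ)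
    (hX : ∀ᵐ a, ∀ b : ℕ → κ₁ ⊕ κ₂ → ℝ, Tendsto b l (𝓝 a) →
      Tendsto (fun N : ℕ => χ N (p + (√(N : ℝ))⁻¹ • J (b N))) l (𝓝 (X a))) :
    Tendsto (fun N : ℕ => cellVolume T N * (Real.exp (-(N * entropy p)) *
      ∑ n ∈ datasets R f N, Real.exp (N * entropy (relFreq N n)) * χ N (relFreq N n))) l
      (𝓝 (∫ a, gaussWeight a * X a)) := by
  classical
  have hJc : Continuous J := J.continuous_of_finiteDimensional
  obtain ⟨δ, hδ, hδp⟩ : ∃ δ : ℝ, 0 < δ ∧ ∀ α, δ ≤ p α := by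
    rcases isEmpty_or_nonempty A with h | h
    · exact ⟨1, one_pos, fun α => isEmptyElim α⟩
    · obtain ⟨β, hβ⟩ := Finite.exists_min p
      exact ⟨p β, hpos β, hβ⟩
  -- `N • p` is generally not integral, so the lattice is anchored at some dataset `n₀`; the
  -- resulting shift `a₀` varies with `N`.
  have hbase : ∀ N : ℕ, ∃ (n₀ : A → ℕ) (a₀ : κ₁ ⊕ κ₂ → ℝ), (datasets R f N).Nonempty →
      n₀ ∈ datasets R f N ∧ J a₀ = (fun α => (n₀ α : ℝ)) - (N : ℝ) • p := by
    intro N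
    by_cases h : (datasets R f N).Nonempty
    swap
    · exact ⟨0, 0, fun h' => absurd h' h⟩
    obtain ⟨n₀, hn₀⟩ := h
    have hN : (N : ℝ) ≠ 0 := by exact_mod_cast (pos_of_mem_datasets hn₀).ne'
    have h1 : (fun α => (n₀ α : ℝ)) = (N : ℝ) • relFreq N n₀ := by
      funext α
      simp only [relFreq, Pi.smul_apply, smul_eq_mul]
      field_simp
    obtain ⟨a₀, ha₀⟩ := hJ.exists_eq ((fun α => (n₀ α : ℝ)) - (N : ℝ) • p) (by
      rw [h1, ← smul_sub, Matrix.mulVec_smul, Matrix.mulVec_sub, (mem_datasets.1 hn₀).2.2, hp.1.2,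
        sub_self, smul_zero])
    exact ⟨n₀, a₀, fun _ => ⟨hn₀, ha₀⟩⟩
  choose n₀ a₀ hna using hbase
  -- the distribution with index `k`
  set q : ℕ → (κ₁ ⊕ κ₂ → ℤ) → A → ℝ := fun N k =>
    p + (√(N : ℝ))⁻¹ • J (latticePoint T (a₀ N) N k) with hqdef
  have hq : ∀ {N : ℕ}, (datasets R f N).Nonempty → ∀ k : κ₁ ⊕ κ₂ → ℤ,
      (N : ℝ) • q N k = (fun α => (n₀ N α : ℝ)) + J (T fun i => (k i : ℝ)) := by
    intro N hN k
    have hN0 : (0 : ℝ) < N := by exact_mod_cast pos_of_mem_datasets (hna N hN).1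
    have hc : (N : ℝ) * ((√(N : ℝ))⁻¹ * (√(N : ℝ))⁻¹) = 1 := by
      rw [← mul_inv, Real.mul_self_sqrt hN0.le, mul_inv_cancel₀ hN0.ne']
    simp only [hqdef, latticePoint, map_smul, map_add, (hna N hN).2, smul_add, smul_smul, hc,
      one_smul]
    abel
  have hkk : ∀ (N : ℕ) (n : A → ℕ), ∃ k : κ₁ ⊕ κ₂ → ℤ, n ∈ datasets R f N →
      (fun α => (n α : ℝ)) = (fun α => (n₀ N α : ℝ)) + J (T fun i => (k i : ℝ)) := by
    intro N n
    by_cases hn : n ∈ datasets R f N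
    swap
    · exact ⟨0, fun h => absurd h hn⟩
    have hN : (N : ℝ) ≠ 0 := by exact_mod_cast (pos_of_mem_datasets hn).ne'
    have h1 : ∀ m : A → ℕ, (fun α => (m α : ℝ)) = (N : ℝ) • relFreq N m := by
      intro m
      funext α
      simp only [relFreq, Pi.smul_apply, smul_eq_mul]
      field_simp
    obtain ⟨a, ha⟩ := hJ.exists_eq ((fun α => (n α : ℝ)) - (fun α => (n₀ N α : ℝ))) (by
      rw [h1, h1, ← smul_sub, Matrix.mulVec_smul, Matrix.mulVec_sub, (mem_datasets.1 hn).2.2,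
        (mem_datasets.1 (hna N ⟨n, hn⟩).1).2.2, sub_self, smul_zero])
    obtain ⟨k, hk⟩ := (hT a).1 ⟨fun α => (n α : ℤ) - n₀ N α, by rw [ha]; funext α; simp⟩
    exact ⟨k, fun _ => by rw [← hk, ha]; simp⟩
  choose kk hkk using hkk
  have hqkk : ∀ {N : ℕ} {n : A → ℕ}, n ∈ datasets R f N → q N (kk N n) = relFreq N n := by
    intro N n hn
    have hN : (N : ℝ) ≠ 0 := by exact_mod_cast (pos_of_mem_datasets hn).ne'
    have h := hq ⟨n, hn⟩ (kk N n)
    rw [← hkk N n hn] at h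
    funext α
    have h1 := congrFun h α
    simp only [Pi.smul_apply, smul_eq_mul] at h1
    rw [relFreq, ← h1]
    field_simp
  have hkkinj : ∀ N, Set.InjOn (kk N) (datasets R f N) := by
    intro N n hn m hm h
    have h1 := (hkk N n hn).trans ((h ▸ rfl : _ = _).trans (hkk N m hm).symm)
    exact funext fun α => by exact_mod_cast congrFun h1 α
  have hqmem : ∀ (N : ℕ) (k : κ₁ ⊕ κ₂ → ℤ), (∀ α, 0 ≤ q N k α) → q N k ∈ eqClass R f :=
    fun N k hk => add_mem_eqClass hone hp.1
      (by rw [Matrix.mulVec_smul, hJ.mulVec_eq_zero, smul_zero]) hk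
  -- Nonnegativity is the only obstruction: integrality comes from the lattice, and normalization
  -- and moments from `ker R`.
  have hsurj : ∀ {N : ℕ}, (datasets R f N).Nonempty → ∀ k, (∀ α, 0 ≤ q N k α) →
      ∃ n ∈ datasets R f N, kk N n = k := by
    intro N hN k hk
    have hN0 : (0 : ℝ) < N := by exact_mod_cast pos_of_mem_datasets (hna N hN).1
    obtain ⟨z, hz⟩ := (hT (T fun i => (k i : ℝ))).2 ⟨k, rfl⟩
    have h1 := hq hN k
    rw [hz] at h1
    have h2 : ∀ α, N * q N k α = ((n₀ N α + z α : ℤ) : ℝ) := fun α => by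
      simpa using congrFun h1 α
    have h3 : ∀ α, 0 ≤ (n₀ N α : ℤ) + z α := fun α => by
      have := mul_nonneg hN0.le (hk α)
      rw [h2] at this
      exact_mod_cast this
    have h4 : ∀ α, ((Int.toNat ((n₀ N α : ℤ) + z α) : ℕ) : ℝ) = N * q N k α := fun α => by
      rw [h2, ← Int.cast_natCast, Int.toNat_of_nonneg (h3 α)]
    have h5 : relFreq N (fun α => Int.toNat ((n₀ N α : ℤ) + z α)) = q N k := by
      funext α
      rw [relFreq, h4]
      field_simp
    have h6 : (fun α => Int.toNat ((n₀ N α : ℤ) + z α)) ∈ datasets R f N := by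
      refine mem_datasets.2 ⟨?_, h5 ▸ hqmem N k hk⟩
      have : ((∑ α, Int.toNat ((n₀ N α : ℤ) + z α) : ℕ) : ℝ) = N := by
        rw [Nat.cast_sum]
        simp_rw [h4]
        rw [← Finset.mul_sum, (hqmem N k hk).1.2, mul_one]
      exact_mod_cast this
    refine ⟨_, h6, ?_⟩
    have h7 := hqkk h6
    rw [h5] at h7
    have h8 := hq hN (kk N fun α => Int.toNat ((n₀ N α : ℤ) + z α))
    rw [h7, hq hN k] at h8
    have h9 := T.injective (hJ.injective (add_left_cancel h8))
    funext i
    exact_mod_cast (congrFun h9 i).symm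
  -- Extension by zero to lattice points with a negative frequency; near any fixed limit point these
  -- eventually do not occur.
  set F : ℕ → (κ₁ ⊕ κ₂ → ℤ) → ℝ := fun N k =>
    if ∀ α, 0 ≤ q N k α then Real.exp (-(N * relEnt (q N k) p)) * χ N (q N k) else 0 with hF
  have hlim := tendsto_cellVolume_mul_sum hl T a₀ (fun N => (datasets R f N).image (kk N)) F
    (fun a => gaussWeight a * X a) (c := δ / 4) (by positivity) ?_ ?_ ?_
  · refine hlim.congr fun N => ?_
    rw [Finset.sum_image (hkkinj N), Finset.mul_sum (a := Real.exp _)]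
    congr 1
    refine Finset.sum_congr rfl fun n hn => ?_
    have h1 := (mem_datasets.1 hn).2
    simp only [hF, hqkk hn]
    rw [if_pos h1.1.1, hp.relEnt_eq hpos h1, ← mul_assoc, ← Real.exp_add]
    congr 2
    ring
  · filter_upwards [hne] with N hN k hk
    refine if_neg fun h => hk ?_
    obtain ⟨n, hn, rfl⟩ := hsurj hN k h
    exact Finset.mem_image_of_mem _ hn
  · filter_upwards [hne] with N hN k
    simp only [hF]
    split_ifs with h
    · rw [abs_mul, Real.abs_exp]
      have h1 := hJ.exp_neg_mul_relEnt_le hpos (le_one_of_mem_stdSimplex hp.1.1) hδp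
        (pos_of_mem_datasets (hna N hN).1) (hqmem N k h).1
      exact (mul_le_of_le_one_right (Real.exp_pos _).le (hχ _ _)).trans h1
    · rw [abs_zero]
      exact (Real.exp_pos _).le
  · filter_upwards [hX] with a ha k hk
    have hJk := (hJc.tendsto a).comp hk
    have h1 := tendsto_mul_relEnt hl hpos hJk
    rw [hJ.chiForm_eq] at h1
    have h2 := ((Real.continuous_exp.tendsto _).comp h1.neg).mul (ha _ hk)
    rw [← neg_div] at h2
    refine h2.congr' ?_
    filter_upwards [eventually_nonneg_add hl hpos hJk] with N hN
    exact (if_pos hN).symm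

/-- With no first block the two kernels agree, hence so do the classes. Exact vanishing is needed
because the limit law has an atom at 0, where convergence of the statistic alone would not decide
the case `x = 0`. -/
theorem mul_entropy_sub_eq_zero_of_isEmpty {ι ι' κ₁ κ₂ : Type*} [Fintype κ₁] [Fintype κ₂]
    [IsEmpty κ₁] {R : Matrix ι A ℝ} {R' : Matrix ι' A ℝ} {f p : A → ℝ}
    (himp : ∀ v, R'.mulVec v = 0 → R.mulVec v = 0)
    (hp : IsMaxEnt (eqClass R f) p)
    {J : (κ₁ ⊕ κ₂ → ℝ) →ₗ[ℝ] (A → ℝ)} (hJ : AdaptedCoords R R' p J) (c : ℝ)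
    (b : κ₁ ⊕ κ₂ → ℝ) : entropy p - entropy (maxEnt (eqClass R' (p + c • J b))) = 0 := by
  have hker : ∀ v, R.mulVec v = 0 → R'.mulVec v = 0 := by
    intro v hv
    obtain ⟨a, rfl⟩ := hJ.exists_eq v hv
    exact (hJ.mulVec_eq_zero_iff a).2 fun i => isEmptyElim i
  have h1 : R'.mulVec (p + c • J b) = R'.mulVec p := by
    rw [Matrix.mulVec_add, Matrix.mulVec_smul, hker _ (hJ.mulVec_eq_zero b), smul_zero, add_zero]
  have h2 : eqClass R' p = eqClass R f := by
    ext r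
    refine and_congr_right fun _ => ?_
    rw [← hp.1.2, ← sub_eq_zero, ← Matrix.mulVec_sub, ← sub_eq_zero (a := R.mulVec r),
      ← Matrix.mulVec_sub]
    exact ⟨himp _, hker _⟩
  have h3 := isMaxEnt_maxEnt R' hp.1.1
  rw [eqClass_congr h1, h2, sub_eq_zero]
  rw [h2] at h3
  rw [hp.unique h3]

/-- The scaled entropy difference of nested MaxEnt models is asymptotically chi-squared. -/
theorem tendsto_statCDF {A : Type*} [Fintype A] {κ : Type*} {D D' : ℕ}
    (C : Matrix κ A ℤ) (R : Matrix (Fin D) A ℝ) (R' : Matrix (Fin D') A ℝ)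
    (hR : IsArchitecture C R) (hR' : R'.rank = D')
    (hnested : Implies R' R)
    (f : A → ℝ) (hf : IsEmpirical f)
    (hpos : ∀ α, ∃ p ∈ eqClass R f, 0 < p α) (x : ℝ) :
    Tendsto (fun N : ℕ => statCDF R R' f N x)
      (atTop ⊓ 𝓟 {N | (datasets R f N).Nonempty})
      (𝓝 ((chiSquared (D' - D)).real (Set.Iic x))) := by
  classical
  set l : Filter ℕ := atTop ⊓ 𝓟 {N | (datasets R f N).Nonempty} with hldef
  have hl : l ≤ atTop := inf_le_left
  have hne : ∀ᶠ N in l, (datasets R f N).Nonempty := mem_inf_of_right (mem_principal_self _)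
  have himp : ∀ v, R'.mulVec v = 0 → R.mulVec v = 0 := by
    obtain ⟨T, rfl⟩ := hnested
    intro v hv
    rw [← Matrix.mulVec_mulVec, hv, Matrix.mulVec_zero]
  have hp := isMaxEnt_maxEnt R hf.mem_stdSimplex
  set p := maxEnt (eqClass R f) with hpdef
  have hp0 : ∀ α, 0 < p α := fun α => hp.pos (hpos α)
  obtain ⟨m, J, hJ⟩ := exists_adaptedCoords hR.rank_eq hR' himp hp0
  obtain ⟨T, hT⟩ := exists_lattice_coords hJ.injective fun a => by
    refine Submodule.span_mono ?_ (mem_span_int_of_mulVec_eq_zero C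
      (mulVec_eq_zero_of_span_row_le hR.rowSpace_eq.ge (hJ.mulVec_eq_zero a)))
    rintro w ⟨hw, hn⟩
    exact ⟨hJ.exists_eq w (mulVec_eq_zero_of_span_row_le hR.rowSpace_eq.le hw), hn⟩
  have hden := tendsto_sum_datasets hR.normalization hp hp0 hJ hT hl hne (fun _ _ => 1)
    (fun _ _ => by simp) (fun _ => 1) (Eventually.of_forall fun _ _ _ => tendsto_const_nhds)
  have hnum := tendsto_sum_datasets hR.normalization hp hp0 hJ hT hl hne
    (fun N q => if 2 * N * (entropy p - entropy (maxEnt (eqClass R' q))) ≤ x then 1 else 0)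
    (fun _ _ => by split_ifs <;> simp)
    ({a | ∑ i, a (Sum.inl i) ^ 2 ≤ x}.indicator fun _ => 1) (by
      have hae : ∀ᵐ a : Fin (D' - D) ⊕ Fin m → ℝ,
          IsEmpty (Fin (D' - D)) ∨ ∑ i, a (Sum.inl i) ^ 2 ≠ x := by
        rcases isEmpty_or_nonempty (Fin (D' - D)) with h | h
        · exact Eventually.of_forall fun _ => Or.inl h
        · exact (ae_sum_inl_sq_ne x).mono fun _ => Or.inr
      filter_upwards [hae] with a ha b hb
      simp only [Set.indicator_apply, Set.mem_ofPred_eq]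
      rcases ha with h | h
      · simp only [mul_entropy_sub_eq_zero_of_isEmpty himp hp hJ, mul_zero, Finset.univ_eq_empty,
          Finset.sum_empty]
        exact tendsto_const_nhds
      have hstat := (tendsto_mul_relEnt_maxEnt hl hR.normalization himp hp hp0 hJ hb).const_mul 2
      rw [mul_div_cancel₀ _ two_ne_zero] at hstat
      refine tendsto_const_nhds.congr' ?_
      -- Off the level set the statistic is eventually on the same side of `x` as its limit, so the
      -- indicator is eventually constant.
      rcases h.lt_or_gt with h | h
      · filter_upwards [hstat.eventually_lt_const h] with N hN
        rw [if_pos h.le, if_pos (by rw [mul_assoc]; exact hN.le)]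
      · filter_upwards [hstat.eventually_const_lt h] with N hN
        rw [if_neg h.not_ge, if_neg (by rw [mul_assoc]; exact hN.not_ge)])
  simp only [mul_one] at hden
  have hratio := hnum.div hden integral_gaussWeight_pos.ne'
  rw [chiSquared_real_Iic_eq_ratio (κ₂ := Fin m)]
  have hind : ∀ a : Fin (D' - D) ⊕ Fin m → ℝ,
      gaussWeight a * {a | ∑ i, a (Sum.inl i) ^ 2 ≤ x}.indicator (fun _ => 1) a =
        {a | ∑ i, a (Sum.inl i) ^ 2 ≤ x}.indicator gaussWeight a := fun a => by
    simp only [Set.indicator_apply]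
    split_ifs <;> simp
  simp_rw [hind] at hratio
  refine hratio.congr' ?_
  filter_upwards [hne] with N hN
  obtain ⟨n₀, hn₀⟩ := hN
  have hc := (cellVolume_pos T (pos_of_mem_datasets hn₀)).ne'
  have he := (Real.exp_pos (-(N * entropy p))).ne'
  rw [Pi.div_apply, mul_div_mul_left _ _ hc, mul_div_mul_left _ _ he, statCDF, Finset.sum_filter,
    Finset.sum_div]
  refine Finset.sum_congr rfl fun n hn => ?_
  have hstat : entropyStat R R' N n =
      2 * N * (entropy p - entropy (maxEnt (eqClass R' (relFreq N n)))) := by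
    rw [entropyStat, eqClass_congr (mem_datasets.1 hn).2.2]
  rw [hstat, classProb]
  split_ifs <;> simp

end MaxEntModel

theorem theorem2 {A : Type*} [Fintype A] {κ : Type*} {D D' : ℕ}
    (C : Matrix κ A ℤ) (R : Matrix (Fin D) A ℝ) (R' : Matrix (Fin D') A ℝ)
    (hR : MaxEntModel.IsArchitecture C R) (hR' : R'.rank = D')
    (hnested : MaxEntModel.Implies R' R)
    (f : A → ℝ) (hf : MaxEntModel.IsEmpirical f)
    (hpos : ∀ α, ∃ p ∈ MaxEntModel.eqClass R f, 0 < p α) (x : ℝ) :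
    Tendsto (fun N : ℕ => MaxEntModel.statCDF R R' f N x)
      (atTop ⊓ 𝓟 {N | (MaxEntModel.datasets R f N).Nonempty})
      (𝓝 ((MaxEntModel.chiSquared (D' - D)).real (Set.Iic x))) := by
  exact MaxEntModel.tendsto_statCDF C R R' hR hR' hnested f hf hpos x
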